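/- Let $\pi:Y\to X$ be a fibered manifold (a surjective smooth submersion), $\dim X=n\ge 1$, $\dim Y=n+m$, and work over the domain of a fibered chart $(x^i,y^\sigma)$ of $Y$, with the induced coordinates $(x^i,y^\sigma_J)$ on the jet prolongations of $\pi$, where $J$ is a symmetric multi-index. All equalities below are equalities of forms up to pull-back by the projections between jet prolongations. **Notation.** Let $d_i=\partial_{x^i}+\sum_{\sigma,J}y^\sigma_{Ji}\,\partial_{y^\sigma_J}$ be the total derivatives; $d_i$ also denotes the formal derivative of forms (the Lie derivative along $d_i$), and $d_J$ the iterated one. Let $\omega^\sigma_J=dy^\sigma_J-y^\sigma_{Ji}dx^i$, $ds=dx^1\wedge\dots\wedge dx^n$ and $ds_j=\partial_{x^j}\rfloor ds$. For a form $\alpha$ let $p_l\alpha$ be its $l$-contact component, let $h=p_0$, and let $d_H\alpha=\sum_l p_l\,d\,p_l\alpha$ and $d_V\alpha=\sum_l p_{l+1}\,d\,p_l\alpha$. For an $(n+1)$-form $\alpha$ the interior Euler operator is $$\mathcal I(\alpha)=\sum_\sigma\omega^\sigma\wedge\sum_J(-1)^{|J|}d_J\big(\partial_{y^\sigma_J}\rfloor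 p_1\alpha\big).$$ Writing $p_1\alpha=\sum_{\sigma,J}\omega^\sigma_J\wedge\eta^J_\sigma$ with horizontal $n$-forms $\eta^J_\sigma$, put $\zeta^I_\sigma=\sum_J(-1)^{|J|}\binom{I+J}{J}d_J\eta^{I+J}_\sigma$ and let $\chi^I$ be the $1$-contact $1$-form, a combination of the $\omega^\sigma$, with $\sum_\sigma\omega^\sigma\wedge\zeta^I_\sigma=\chi^I\wedge ds$. The residual operator is $$\mathcal R(\alpha)=-\sum_{I}\sum_{j=1}^n\frac{I_j+1}{|I|+1}\,d_I\chi^{I+e_j}\wedge ds_j .$$ For an $n$-form $\lambda$ horizontal over $X$ put $E_n(\lambda)=\mathcal I(d\lambda)$ (the Euler--Lagrange form) and $p_{d_V\lambda}=-p_1\mathcal R(d\lambda)$ (the local generalized momentum). For a projectable vector field $\Xi=\xi^i(x)\partial_{x^i}+\xi^\sigma(x,y)\partial_{y^\sigma}$ on $Y$ put $$\Xi_H=\xi^i d_i,\qquad J\Xi_V=\sum_{\sigma,J}d_J\big(\xi^\sigma-y^\sigma_i\xi^i\big)\,\partial_{y^\sigma_J},\qquad \epsilon_\Xi(\lambda)=J\Xi_V\rfloor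 p_{d_V\lambda}+\Xi_H\rfloor\lambda ;$$ $\epsilon_\Xi(\lambda)$ is the Noether current. For vertical $\Xi$ one has $\Xi_H=0$, $J\Xi_V=J\Xi$ is the prolongation of $\Xi$, and $\Xi\rfloor E_n(\lambda)=J\Xi\rfloor E_n(\lambda)$. **Proposition.** Let $\rho$ be a smooth $n$-form on the $r$-th jet prolongation over the domain of the chart, let $h\rho$ be the associated Lagrangian, and let $\Xi_1,\Xi_2$ be smooth vector fields on $Y$. 1. If $\Xi_1$ and $\Xi_2$ are projectable, then $$d_H\big(J\Xi_{2,V}\rfloor p_{d_Vd_H(J\Xi_{1,V}\rfloor p_{d_Vh\rho}+\Xi_{1,H}\rfloor h\rho)}\big)=d_H\Big(h\big(J\Xi_{2,V}\rfloor d_V(J\Xi_{1,V}\rfloor p_{d_Vh\rho}+\Xi_{1,H}\rfloor h\rho)\big)\Big).$$ 2. If $\Xi_1$ and $\Xi_2$ are vertical, then $$\Xi_1\rfloor E_n(\Xi_2\rfloor E_n(h\rho))+[\Xi_2,\Xi_1]\rfloor E_n(h\rho)=\Xi_2\rfloor E_n(\Xi_1\rfloor E_n(h\rho))+d_H\epsilon_{\Xi_2}(\Xi_1\rfloor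 E_n(h\rho)).$$ 3. If $\Xi_1$ and $\Xi_2$ are vertical, then $$d_H\epsilon_{\Xi_2}(\Xi_1\rfloor E_n(h\rho))+d_H\epsilon_{\Xi_1}(\Xi_2\rfloor E_n(h\rho))=0.$$ -/

import Mathlib

open scoped Manifold ContDiff

noncomputable section

namespace JetCalculus

/-- Symmetric multi-indices `J = (J₁, …, J_N)`; `|J|` is `∑ i, J i`. The index `Ji` is `J + e_i`. -/
abbrev MultiIndex (N : ℕ) := Fin N → ℕ

/-- The multi-index `(i)` of length one. -/
def unitIndex {N : ℕ} (i : Fin N) : MultiIndex N := Pi.single i 1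

/-- The multi-indices of length at most `r`. -/
def multiIndices (N r : ℕ) : Finset (MultiIndex N) :=
  (Fintype.piFinset fun _ : Fin N => Finset.range (r + 1)).filter fun J => ∑ i, J i ≤ r

theorem zero_mem_multiIndices (N r : ℕ) : (0 : MultiIndex N) ∈ multiIndices N r := by
  simp [multiIndices]

theorem mem_multiIndices {N r : ℕ} {J : MultiIndex N} :
    J ∈ multiIndices N r ↔ ∑ i, J i ≤ r := by
  simp only [multiIndices, Finset.mem_filter, Fintype.mem_piFinset, Finset.mem_range,
    and_iff_right_iff_imp]
  intro h i
  exact Nat.lt_succ_of_le ((Finset.single_le_sum (fun _ _ => Nat.zero_le _)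
    (Finset.mem_univ i)).trans h)

/-- Multi-index binomial coefficient `∏ i, (K i choose J i)`. -/
def multiChoose {N : ℕ} (K J : MultiIndex N) : ℕ := ∏ i, (K i).choose (J i)

/-! ### Jet coordinates

`FinJet N m r` is the space of values of the fibred coordinates `(x^i, y^σ_J)`, `|J| ≤ r`, on the
jets of order `r`. `Jet N m` is the space of values of all `(x^i, y^σ_J)`. Objects of finite order
are pulled back to it along the projection `truncate r`, which is surjective, so that two forms
agree up to pull-back by the jet projections exactly if their pull-backs to `Jet N m` agree. -/

/-- Fibred coordinates `(x^i, y^σ_J)`, `|J| ≤ r`, of jets of order `r`. -/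
abbrev FinJet (N m r : ℕ) := (Fin N → ℝ) × (Fin m → multiIndices N r → ℝ)

/-- Fibred coordinates `(x^i, y^σ_J)` of jets of unbounded order; also the tangent vectors,
with components `(dx^i, dy^σ_J)`, at such a point. -/
abbrev Jet (N m : ℕ) := (Fin N → ℝ) × (Fin m → MultiIndex N → ℝ)

/-- The projection to the jets of order `r`. -/
def truncate {N m : ℕ} (r : ℕ) (p : Jet N m) : FinJet N m r := (p.1, fun σ J => p.2 σ J)

/-- The coordinates `(x^i, y^σ)` of the underlying point of the total space. -/
def basePoint {N m : ℕ} (p : Jet N m) : (Fin N → ℝ) × (Fin m → ℝ) := (p.1, fun σ => p.2 σ 0)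

/-- A differential `q`-form in jet coordinates: its value at a point on `q` tangent vectors.
All forms below are obtained from a smooth form on a jet space of finite order (and smooth vector
fields), and are then alternating and multilinear in the tangent vectors. -/
abbrev Form (N m q : ℕ) := Jet N m → (Fin q → Jet N m) → ℝ

/-- A vector field in jet coordinates. -/
abbrev JetField (N m : ℕ) := Jet N m → Jet N m

variable {N m n q r : ℕ}

/-- The pull-back of a `q`-form on the jets of order `r`. -/
def pullForm (ρ : FinJet N m r → FinJet N m r [⋀^Fin q]→L[ℝ] ℝ) : Form N m q :=
  fun p v => ρ (truncate r p) fun k => truncate r (v k)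

/-- The total derivative vector field `d_i = ∂/∂x^i + ∑ y^σ_{Ji} ∂/∂y^σ_J`. -/
def totalVec (i : Fin N) : JetField N m :=
  fun p => (Pi.single i 1, fun σ J => p.2 σ (J + unitIndex i))

/-- The vector field `∂/∂y^σ_J`. -/
def partialY (σ : Fin m) (J : MultiIndex N) : JetField N m :=
  fun _ => (0, Pi.single σ (Pi.single J 1))

/-- The total derivative of a function. -/
def totalDeriv (i : Fin N) (f : Jet N m → ℝ) : Jet N m → ℝ :=
  fun p => lineDeriv ℝ f p (totalVec i p)

/-- The iteration `D_J = D_1^{J_1} ⋯ D_N^{J_N}` of operators `D_i`. -/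
def iter {A : Type*} (D : Fin N → A → A) (J : MultiIndex N) (a : A) : A :=
  (List.finRange N).foldr (fun i b => (D i)^[J i] b) a

/-- The horizontal component `dx^i(v) d_i` of the tangent vector `v` at `p`. -/
def horVec (p v : Jet N m) : Jet N m := ∑ i, v.1 i • totalVec i p

/-- The vertical component `v - dx^i(v) d_i = ω^σ_J(v) ∂/∂y^σ_J` of the tangent vector `v`
at `p`. -/
def vertVec (p v : Jet N m) : Jet N m := v - horVec p v

/-- The contact component `p_l`: the sum, over all ways to choose `l` of the arguments, of the
values on the vertical components of these arguments and the horizontal components of the others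
(as the form is alternating, the arguments may stay in their places and no sign occurs). -/
def contactPart (l : ℕ) (α : Form N m q) : Form N m q := fun p v =>
  ∑ S ∈ Finset.powersetCard l (Finset.univ : Finset (Fin q)),
    α p fun k => if k ∈ S then vertVec p (v k) else horVec p (v k)

/-- Horizontalization `h = p_0`. -/
def horizontalization (α : Form N m q) : Form N m q := contactPart 0 α

/-- The exterior derivative. -/
def extD (α : Form N m q) : Form N m (q + 1) := fun p v =>
  ∑ k : Fin (q + 1), (-1 : ℝ) ^ (k : ℕ) * lineDeriv ℝ (fun p' => α p' (k.removeNth v)) p (v k)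

/-- The horizontal differential `d_H = ∑_l p_l d p_l`. -/
def dH (α : Form N m q) : Form N m (q + 1) :=
  ∑ l ∈ Finset.range (q + 1), contactPart l (extD (contactPart l α))

/-- The vertical differential `d_V = ∑_l p_{l+1} d p_l`. -/
def dV (α : Form N m q) : Form N m (q + 1) :=
  ∑ l ∈ Finset.range (q + 1), contactPart (l + 1) (extD (contactPart l α))

/-- The contraction `Φ ⌋ α` in the first argument. -/
def contract (Φ : JetField N m) (α : Form N m (q + 1)) : Form N m q :=
  fun p v => α p (Fin.cons (Φ p) v)

/-- The wedge product of a one-form and a `q`-form. -/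
def wedge (θ : Form N m 1) (α : Form N m q) : Form N m (q + 1) := fun p v =>
  ∑ k : Fin (q + 1), (-1 : ℝ) ^ (k : ℕ) * (θ p (fun _ => v k) * α p (k.removeNth v))

/-- The contact form `ω^σ = dy^σ - y^σ_i dx^i`. -/
def contactForm (σ : Fin m) : Form N m 1 :=
  fun p v => (v 0).2 σ 0 - ∑ i, p.2 σ (unitIndex i) * (v 0).1 i

/-- The volume element `ds = dx^1 ∧ ⋯ ∧ dx^N`. -/
def ds : Form N m N := fun _ v => Matrix.det (Matrix.of fun k i => (v k).1 i)

/-- `ds_j = ∂/∂x^j ⌋ ds`. -/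
def dsContract (j : Fin (n + 1)) : Form (n + 1) m n :=
  contract (fun _ => (Pi.single j 1, 0)) ds

/-- The formal derivative `d_i` of forms, that is the Lie derivative along `totalVec i`. It obeys
the Leibniz rule, commutes with the exterior derivative, is the total derivative on functions, and
`d_i dx^j = 0`, `d_i dy^σ_J = dy^σ_{Ji}`. -/
def formalDeriv (i : Fin N) (α : Form N m q) : Form N m q := fun p v =>
  lineDeriv ℝ (fun p' => α p' v) p (totalVec i p) +
    ∑ k, α p (Function.update v k (0, fun σ J => (v k).2 σ (J + unitIndex i)))

/-! ### Interior Euler operator and residual operator -/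

/-- The interior Euler operator
`𝓘(α) = (1/k) ω^σ ∧ ∑_J (-1)^{|J|} d_J (∂/∂y^σ_J ⌋ p_k α)` on `(N+k)`-forms (so `q + 1 = N + k`).
For forms of finite order the sum over `J` is finite. -/
def interiorEuler (k : ℕ) (α : Form N m (q + 1)) : Form N m (q + 1) :=
  (1 / (k : ℝ)) • ∑ σ, wedge (contactForm σ) fun p v =>
    ∑ᶠ J : MultiIndex N, (-1 : ℝ) ^ (∑ i, J i) *
      iter formalDeriv J (contract (partialY σ J) (contactPart k α)) p v

/-- For an `(N+1)`-form `α`, with `p_1 α = ∑ ω^σ_J ∧ η^J_σ`, the coefficient `z^I_σ` of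
`ζ^I_σ = ∑_J (-1)^{|J|} (I+J choose J) d_J η^{I+J}_σ = z^I_σ ds`. -/
def zetaCoeff (α : Form N m (N + 1)) (σ : Fin m) (I : MultiIndex N) : Jet N m → ℝ := fun p =>
  ∑ᶠ J : MultiIndex N, (-1 : ℝ) ^ (∑ i, J i) * (multiChoose (I + J) J : ℝ) *
    iter formalDeriv J (contract (partialY σ (I + J)) (contactPart 1 α)) p
      fun i => (Pi.single i 1, 0)

/-- The one-contact one-form `χ^I = z^I_σ ω^σ`, so that `ω^σ ∧ ζ^I_σ = χ^I ∧ ds`. -/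
def chi (α : Form N m (N + 1)) (I : MultiIndex N) : Form N m 1 :=
  fun p v => ∑ σ, zetaCoeff α σ I p * contactForm σ p v

/-- The residual operator on `(N+1)`-forms, `𝓡(α) = - ∑_{I,j} d_I χ^{Ij} ∧ ds_j`, the sum being
over ordered index tuples `(I, j)` with `χ` symmetric. Written over unordered `I`, the
term `(I, j)` carries the weight `(I_j + 1) / (|I| + 1)`: this is the proportion, among the
orderings of the multi-index `I + e_j`, of those with last entry `j`. -/
def residual (α : Form (n + 1) m (n + 2)) : Form (n + 1) m (n + 1) := fun p v =>
  - ∑ᶠ I : MultiIndex (n + 1), ∑ j, (((I j : ℝ) + 1) / ((∑ i, (I i : ℝ)) + 1)) *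
    wedge (iter formalDeriv I (chi α (I + unitIndex j))) (dsContract j) p v

/-- The Euler-Lagrange form `E_n(λ) = 𝓘(dλ)` of a Lagrangian `λ`. -/
def eulerLagrange (lam : Form N m q) : Form N m (q + 1) := interiorEuler 1 (extD lam)

/-- The local generalized momentum `p_{d_V λ} = - p_1 𝓡(dλ)`. -/
def momentum (lam : Form (n + 1) m (n + 1)) : Form (n + 1) m (n + 1) :=
  - contactPart 1 (residual (extD lam))

/-! ### Fibred manifolds, fibred charts and vector fields -/

/-- The model space of the total space. -/
abbrev TotalModel (N m : ℕ) := (Fin N → ℝ) × (Fin m → ℝ)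

variable {X Y : Type*} [TopologicalSpace X] [ChartedSpace (Fin N → ℝ) X]
  [TopologicalSpace Y] [ChartedSpace (TotalModel N m) Y]

/-- `π : Y → X` is a fibred manifold: a surjective smooth submersion. -/
def IsFiberedManifold [IsManifold 𝓘(ℝ, Fin N → ℝ) ∞ X] [IsManifold 𝓘(ℝ, TotalModel N m) ∞ Y]
    (π : Y → X) : Prop :=
  Function.Surjective π ∧
    Manifold.IsSubmersion 𝓘(ℝ, TotalModel N m) 𝓘(ℝ, Fin N → ℝ) ∞ π

/-- A fibred chart: a chart `(x^i, y^σ)` of the total space, over a chart `(x^i)` of the base. -/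
structure FiberedChart (π : Y → X) where
  total : OpenPartialHomeomorph Y (TotalModel N m)
  baseChart : OpenPartialHomeomorph X (Fin N → ℝ)
  total_mem : total ∈ IsManifold.maximalAtlas 𝓘(ℝ, TotalModel N m) ∞ Y
  base_mem : baseChart ∈ IsManifold.maximalAtlas 𝓘(ℝ, Fin N → ℝ) ∞ X
  maps : ∀ y ∈ total.source, π y ∈ baseChart.source
  compat : ∀ y ∈ total.source, baseChart (π y) = (total y).1

/-- A vector field on the total space. -/
abbrev TotalField (N m : ℕ) (Y : Type*) [TopologicalSpace Y] [ChartedSpace (TotalModel N m) Y] :=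
  (y : Y) → TangentSpace 𝓘(ℝ, TotalModel N m) y

/-- Smoothness of a vector field. -/
def IsSmoothField [IsManifold 𝓘(ℝ, TotalModel N m) ∞ Y] (Ξ : TotalField N m Y) : Prop :=
  ContMDiff 𝓘(ℝ, TotalModel N m) 𝓘(ℝ, TotalModel N m).tangent ∞
    fun y => (⟨y, Ξ y⟩ : TangentBundle 𝓘(ℝ, TotalModel N m) Y)

/-- `Ξ` is projectable: it is `π`-related to a vector field on the base (which is then smooth if
`Ξ` is, as `π` is a surjective submersion). -/
def IsProjectable (π : Y → X) (Ξ : TotalField N m Y) : Prop :=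
  ∃ ξ : (x : X) → TangentSpace 𝓘(ℝ, Fin N → ℝ) x, ∀ y,
    mfderiv 𝓘(ℝ, TotalModel N m) 𝓘(ℝ, Fin N → ℝ) π y (Ξ y) = ξ (π y)

/-- `Ξ` is vertical. -/
def IsVertical (π : Y → X) (Ξ : TotalField N m Y) : Prop :=
  ∀ y, mfderiv 𝓘(ℝ, TotalModel N m) 𝓘(ℝ, Fin N → ℝ) π y (Ξ y) = 0

namespace FiberedChart

variable {π : Y → X} (c : FiberedChart (N := N) (m := m) π)

/-- The part of the coordinate jet space that lies over the domain of the chart. -/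
def jetDomain : Set (Jet N m) := {p | basePoint p ∈ c.total.target}

/-- The part of the coordinate jet space of order `r` that lies over the domain of the chart. -/
def finJetDomain (r : ℕ) : Set (FinJet N m r) :=
  {p | (p.1, fun σ => p.2 σ ⟨0, zero_mem_multiIndices N r⟩) ∈ c.total.target}

/-- The components `(ξ^i, ξ^σ)` of a vector field in the chart. -/
def components (Ξ : TotalField N m Y) (z : TotalModel N m) : TotalModel N m :=
  letI : ChartedSpace (TotalModel N m) (TotalModel N m) := chartedSpaceSelf _
  mfderiv 𝓘(ℝ, TotalModel N m) 𝓘(ℝ, TotalModel N m) c.total (c.total.symm z)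
    (Ξ (c.total.symm z))

/-- The components `ξ^σ - y^σ_i ξ^i` of the vertical part `Ξ_V`. -/
def vertComponent (Ξ : TotalField N m Y) (σ : Fin m) (p : Jet N m) : ℝ :=
  (c.components Ξ (basePoint p)).2 σ - ∑ i, p.2 σ (unitIndex i) * (c.components Ξ (basePoint p)).1 i

/-- The prolonged vertical part `JΞ_V = ∑_J d_J(ξ^σ - y^σ_i ξ^i) ∂/∂y^σ_J`. For vertical `Ξ` this
is the prolongation `JΞ = ∑_J d_J ξ^σ ∂/∂y^σ_J` of `Ξ`. -/
def prolongV (Ξ : TotalField N m Y) : JetField N m :=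
  fun p => (0, fun σ J => iter totalDeriv J (c.vertComponent Ξ σ) p)

/-- The horizontal part `Ξ_H = ξ^i d_i`. -/
def partH (Ξ : TotalField N m Y) : JetField N m :=
  fun p => ∑ i, (c.components Ξ (basePoint p)).1 i • totalVec i p

end FiberedChart

/-- The Noether current `ε_Ξ(λ) = JΞ_V ⌋ p_{d_V λ} + Ξ_H ⌋ λ`. -/
def noetherCurrent {X Y : Type*} [TopologicalSpace X] [ChartedSpace (Fin (n + 1) → ℝ) X]
    [TopologicalSpace Y] [ChartedSpace (TotalModel (n + 1) m) Y] {π : Y → X}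
    (c : FiberedChart (N := n + 1) (m := m) π) (Ξ : TotalField (n + 1) m Y)
    (lam : Form (n + 1) m (n + 1)) : Form (n + 1) m n :=
  contract (c.prolongV Ξ) (momentum lam) + contract (c.partH Ξ) lam

end JetCalculus

end

open JetCalculus

/-!
In the coordinates of a fibred chart every form in the statement is determined, over the domain of
the chart, by coefficient functions: a horizontal `(n+1)`-form is `f ds` (`IsVolumeForm`), a
horizontal `n`-form is `∑ f_j ds_j` (`IsCurrent`), and the residual operator only involves
combinations of the contact forms `ω^σ_K` (`IsContactForm`). The coefficients are smooth functions
of finite order. They form an algebra `JetFun` with commuting total derivatives `d_i` and partial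
derivatives `∂/∂y^σ_J`, where `[∂/∂y^σ_J, d_i] = ∂/∂y^σ_{J - e_i}`; the commutators come from the
symmetry of second derivatives. This structure, `JetAlgebra`, is all that the variational
identities need. Writing `E_σ` for the Euler operator, `J_u` for the derivative along the prolonged
vertical field with components `u`, and `P_u(f)` for the contraction of that field with the
momentum of `f ds`, they are

* the first variation formula `∑_j d_j P_u(f)^j = J_u f - u^σ E_σ(f)` (`divergence_mom`), which is
  repeated integration by parts, organised by the multi-index identity `sum_multiChoose_dJ`;
* `E_σ(d_i f) = 0` (`euler_d`) and `J_u d_i = d_i J_u` (`prol_d`);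
* the naturality `E_σ(J_ξ f) = J_ξ(E_σ f) + ∂ξ^ν/∂y^σ E_ν(f)` for a field `ξ` on the total space
  (`euler_prol`).

The first equality compares `∑_j d_j P_u(∑_i d_i f^i)^j` with `∑_i d_i J_u f^i`: by the first
variation formula the difference is `u^σ E_σ(∑_i d_i f^i) = 0`. For the second, the right-hand side
is `J_{Ξ₂}(Ξ₁ ⌋ E(λ))` by the first variation formula, and on the left `E(Ξ₂ ⌋ E(λ)) = E(J_{Ξ₂} L)`,
as the two differ by a divergence; naturality and the product rule then leave the components
`J_{Ξ₂} ξ₁ - J_{Ξ₁} ξ₂` of the bracket `[Ξ₂, Ξ₁]` (`second_variation`). The third equality is the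
sum of the second one and the same with `Ξ₁` and `Ξ₂` exchanged.
-/

noncomputable section

namespace JetCalculus

/-! ### Multi-indices -/

section MultiIndices

variable {N : ℕ} {M : Type*} [AddCommMonoid M]

theorem sum_add_unitIndex (J : MultiIndex N) (i : Fin N) :
    ∑ k, (J + unitIndex i) k = ∑ k, J k + 1 := by
  simp [unitIndex, Finset.sum_add_distrib, Finset.sum_pi_single']

theorem sub_unitIndex_add {J : MultiIndex N} {i : Fin N} (h : J i ≠ 0) :
    J - unitIndex i + unitIndex i = J := by
  funext k
  by_cases hk : k = i
  · subst hk
    simp [unitIndex]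
    omega
  · simp [unitIndex, hk]

theorem add_unitIndex_sub (J : MultiIndex N) (i : Fin N) :
    J + unitIndex i - unitIndex i = J := by
  funext k
  simp

theorem MultiIndex.induction_on {P : MultiIndex N → Prop} (J : MultiIndex N) (zero : P 0)
    (add_unit : ∀ J i, P J → P (J + unitIndex i)) : P J := by
  induction h : ∑ i, J i generalizing J with
  | zero =>
    have : J = 0 := by
      funext i
      exact (Finset.sum_eq_zero_iff.mp h) i (Finset.mem_univ i)
    rwa [this]
  | succ k ih =>
    obtain ⟨i, hi⟩ : ∃ i, J i ≠ 0 := by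
      by_contra! hc
      simp [hc] at h
    have hJ := sub_unitIndex_add hi
    rw [← hJ]
    apply add_unit
    apply ih
    have := sum_add_unitIndex (J - unitIndex i) i
    rw [hJ] at this
    omega

theorem sum_multiIndices_of_le {R S : ℕ} (hRS : R ≤ S) {g : MultiIndex N → M}
    (hg : ∀ J, R < ∑ i, J i → g J = 0) :
    ∑ J ∈ multiIndices N S, g J = ∑ J ∈ multiIndices N R, g J := by
  symm
  apply Finset.sum_subset
  · intro J hJ
    rw [mem_multiIndices] at *
    omega
  · intro J _ hJ
    rw [mem_multiIndices] at hJ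
    exact hg J (by omega)

theorem finsum_eq_sum_multiIndices (R : ℕ) {g : MultiIndex N → M}
    (hg : ∀ J, R < ∑ i, J i → g J = 0) :
    ∑ᶠ J, g J = ∑ J ∈ multiIndices N R, g J := by
  apply finsum_eq_sum_of_support_subset
  intro J hJ
  rw [Finset.mem_coe, mem_multiIndices]
  by_contra h
  exact hJ (hg J (by omega))

/-- Reindexing of a sum over multi-indices by `J ↦ J + e_i`. -/
theorem sum_multiIndices_shift (R : ℕ) (i : Fin N) (g : MultiIndex N → M) :
    (∑ J ∈ multiIndices N (R + 1), if J i = 0 then 0 else g (J - unitIndex i)) =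
      ∑ J ∈ multiIndices N R, g J := by
  symm
  refine Finset.sum_of_injOn (fun J => J + unitIndex i) ?_ ?_ ?_ ?_
  · intro J _ K _ h
    exact add_right_cancel h
  · intro J hJ
    rw [Finset.mem_coe, mem_multiIndices] at *
    rw [sum_add_unitIndex]
    omega
  · intro J hJ hJ'
    rw [if_pos]
    by_contra h
    apply hJ'
    refine ⟨J - unitIndex i, ?_, sub_unitIndex_add h⟩
    have := sum_add_unitIndex (J - unitIndex i) i
    rw [sub_unitIndex_add h] at this
    rw [Finset.mem_coe, mem_multiIndices]
    rw [mem_multiIndices] at hJ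
    omega
  · intro J _
    rw [if_neg (by simp [unitIndex]), add_unitIndex_sub]

open Classical in
/-- Reindexing of a sum over multi-indices by `I ↦ I + J`. -/
theorem sum_multiIndices_add (R : ℕ) (J : MultiIndex N) (g : MultiIndex N → MultiIndex N → M)
    (hg : ∀ K I, R < ∑ i, K i → g K I = 0) :
    ∑ I ∈ multiIndices N R, g (I + J) I =
      ∑ K ∈ multiIndices N R, if J ≤ K then g K (K - J) else 0 := by
  rw [← Finset.sum_filter]
  have key : ∀ I : MultiIndex N, ∑ i, (I + J) i = ∑ i, I i + ∑ i, J i := fun I => by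
    simp [Finset.sum_add_distrib]
  symm
  refine Finset.sum_of_injOn (fun K => K - J) ?_ ?_ ?_ ?_
  · intro K hK K' hK' h
    simp only [Finset.coe_filter, Set.mem_ofPred_eq] at hK hK'
    have h' : K - J + J = K' - J + J := by
      simp only at h
      rw [h]
    rwa [tsub_add_cancel_of_le hK.2, tsub_add_cancel_of_le hK'.2] at h'
  · intro K hK
    simp only [Finset.coe_filter, Set.mem_ofPred_eq, mem_multiIndices] at hK
    rw [Finset.mem_coe, mem_multiIndices]
    have := key (K - J)
    rw [tsub_add_cancel_of_le hK.2] at this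
    dsimp only
    omega
  · intro I _ hI
    apply hg
    by_contra h
    apply hI
    refine ⟨I + J, ?_, by simp⟩
    simp only [Finset.coe_filter, Set.mem_ofPred_eq, mem_multiIndices]
    exact ⟨by omega, by simp⟩
  · intro K hK
    simp only [Finset.mem_filter] at hK
    rw [tsub_add_cancel_of_le hK.2]

theorem multiChoose_eq_zero {K J : MultiIndex N} (h : ¬ J ≤ K) : multiChoose K J = 0 := by
  rw [Pi.le_def] at h
  push Not at h
  obtain ⟨i, hi⟩ := h
  exact Finset.prod_eq_zero (Finset.mem_univ i) (Nat.choose_eq_zero_of_lt hi)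

theorem multiChoose_zero_right (K : MultiIndex N) : multiChoose K 0 = 1 := by
  simp [multiChoose]

theorem multiChoose_sub {K J : MultiIndex N} (h : J ≤ K) :
    multiChoose K (K - J) = multiChoose K J :=
  Finset.prod_congr rfl fun i _ => Nat.choose_symm (h i)

/-- Pascal's rule in the `i`-th entry. -/
theorem multiChoose_add_unitIndex (K J : MultiIndex N) (i : Fin N) :
    multiChoose (K + unitIndex i) J =
      multiChoose K J + if J i = 0 then 0 else multiChoose K (J - unitIndex i) := by
  have h1 : ∀ L L' : MultiIndex N, multiChoose L L' =
      (L i).choose (L' i) * ∏ k ∈ Finset.univ.erase i, (L k).choose (L' k) := fun L L' =>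
    (Finset.mul_prod_erase _ _ (Finset.mem_univ i)).symm
  have h2 : ∀ L L' : MultiIndex N, (∀ k ≠ i, L k = K k ∧ L' k = J k) →
      ∏ k ∈ Finset.univ.erase i, (L k).choose (L' k) =
        ∏ k ∈ Finset.univ.erase i, (K k).choose (J k) := fun L L' h =>
    Finset.prod_congr rfl fun k hk => by
      obtain ⟨ha, hb⟩ := h k (Finset.ne_of_mem_erase hk)
      rw [ha, hb]
  have h3 : ∀ k ≠ i, (K + unitIndex i) k = K k := fun k hk => by simp [unitIndex, hk]
  have h4 : ∀ k ≠ i, (J - unitIndex i) k = J k := fun k hk => by simp [unitIndex, hk]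
  rw [h1, h1 K J, h1 K (J - unitIndex i), h2 _ _ fun k hk => ⟨h3 k hk, rfl⟩,
    h2 _ _ fun k hk => ⟨rfl, h4 k hk⟩]
  have h5 : (K + unitIndex i) i = K i + 1 := by simp [unitIndex]
  have h6 : (J - unitIndex i) i = J i - 1 := by simp [unitIndex]
  rw [h5, h6]
  obtain h | h := Nat.eq_zero_or_pos (J i)
  · simp [h]
  · obtain ⟨j, hj⟩ := Nat.exists_eq_add_of_lt h
    rw [if_neg (by omega), hj]
    simp only [zero_add, Nat.add_sub_cancel, Nat.choose_succ_succ']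
    ring

end MultiIndices

/-! ### Iterated operators -/

section Iter

variable {N : ℕ} {A B : Type*}

theorem iter_zero (D : Fin N → A → A) (a : A) : iter D 0 a = a := by
  unfold iter
  induction List.finRange N with
  | nil => rfl
  | cons k l _ => simp

theorem iter_add_unitIndex (D : Fin N → A → A) (hD : ∀ i j a, D i (D j a) = D j (D i a))
    (J : MultiIndex N) (i : Fin N) (a : A) :
    iter D (J + unitIndex i) a = D i (iter D J a) := by
  have hit : ∀ i j n a, D i ((D j)^[n] a) = (D j)^[n] (D i a) := fun i j n a => by
    induction n generalizing a with
    | zero => rfl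
    | succ n ih => rw [Function.iterate_succ_apply, ih, hD, Function.iterate_succ_apply]
  have hnot : ∀ l : List (Fin N), i ∉ l →
      l.foldr (fun k b => (D k)^[(J + unitIndex i) k] b) a =
        l.foldr (fun k b => (D k)^[J k] b) a := fun l hl => by
    induction l with
    | nil => rfl
    | cons k l ih =>
      rw [List.mem_cons, not_or] at hl
      simp only [List.foldr_cons]
      rw [ih hl.2]
      simp [unitIndex, Ne.symm hl.1]
  have hmem : ∀ l : List (Fin N), l.Nodup → i ∈ l →
      l.foldr (fun k b => (D k)^[(J + unitIndex i) k] b) a =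
        D i (l.foldr (fun k b => (D k)^[J k] b) a) := fun l hl hi => by
    induction l with
    | nil => simp at hi
    | cons k l ih =>
      rw [List.nodup_cons] at hl
      simp only [List.foldr_cons]
      by_cases hk : i = k
      · subst hk
        rw [hnot l hl.1]
        simp only [Pi.add_apply, unitIndex, Pi.single_eq_same]
        rw [Function.iterate_succ_apply']
      · have hil : i ∈ l := by simpa [hk] using hi
        rw [ih hl.2 hil, hit]
        simp [unitIndex, Ne.symm hk]
  exact hmem _ (List.nodup_finRange N) (List.mem_finRange i)

/-- A relation that is preserved by the operators is preserved by their iterates. -/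
theorem iter_rel (D : Fin N → A → A) (D' : Fin N → B → B) (r : A → B → Prop)
    (h : ∀ i a b, r a b → r (D i a) (D' i b)) (J : MultiIndex N) {a : A} {b : B} (hab : r a b) :
    r (iter D J a) (iter D' J b) := by
  unfold iter
  induction List.finRange N with
  | nil => exact hab
  | cons k l ih =>
    simp only [List.foldr_cons]
    generalize J k = n
    induction n with
    | zero => exact ih
    | succ n ih' =>
      rw [Function.iterate_succ_apply', Function.iterate_succ_apply']
      exact h _ _ _ ih'

end Iter

/-! ### Differential algebra of jets -/

/-- The algebraic structure of the smooth functions of finite order on a jet space: commuting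
total derivatives `d i` and partial derivatives `pd σ J` along `y^σ_J`, with
`[∂/∂y^σ_{J}, d_i] = ∂/∂y^σ_{J - e_i}`, such that every element has finite order. -/
structure JetAlgebra (N m : ℕ) (A : Type*) [CommRing A] [Algebra ℝ A] where
  d : Fin N → Derivation ℝ A A
  pd : Fin m → MultiIndex N → Derivation ℝ A A
  d_comm : ∀ i j f, d i (d j f) = d j (d i f)
  pd_comm : ∀ σ J τ K f, pd σ J (pd τ K f) = pd τ K (pd σ J f)
  pd_d : ∀ σ J i f, pd σ J (d i f) =
    d i (pd σ J f) + if J i = 0 then 0 else pd σ (J - unitIndex i) f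
  exists_order : ∀ f, ∃ R, ∀ σ J, R < ∑ i, J i → pd σ J f = 0

namespace JetAlgebra

variable {N m : ℕ} {A : Type*} [CommRing A] [Algebra ℝ A] (V : JetAlgebra N m A)

/-- `f` depends only on the `y^σ_J` with `|J| ≤ R`. -/
def HasOrder (R : ℕ) (f : A) : Prop := ∀ σ J, R < ∑ i, J i → V.pd σ J f = 0

variable {V}

theorem HasOrder.mono {R S : ℕ} {f : A} (h : V.HasOrder R f) (hRS : R ≤ S) : V.HasOrder S f :=
  fun σ J hJ => h σ J (hRS.trans_lt hJ)

theorem HasOrder.pd {R : ℕ} {f : A} (h : V.HasOrder R f) (τ : Fin m) (K : MultiIndex N) :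
    V.HasOrder R (V.pd τ K f) := fun σ J hJ => by
  rw [V.pd_comm, h σ J hJ, map_zero]

theorem HasOrder.d {R : ℕ} {f : A} (h : V.HasOrder R f) (i : Fin N) :
    V.HasOrder (R + 1) (V.d i f) := fun σ J hJ => by
  rw [V.pd_d, h σ J (by omega), map_zero, zero_add]
  split_ifs with hi
  · rfl
  · apply h
    have := sum_add_unitIndex (J - unitIndex i) i
    rw [sub_unitIndex_add hi] at this
    omega

variable (V)

theorem exists_hasOrder (f : A) : ∃ R, V.HasOrder R f := V.exists_order f

theorem exists_hasOrder₂ (f g : A) : ∃ R, V.HasOrder R f ∧ V.HasOrder R g := by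
  obtain ⟨R, hR⟩ := V.exists_hasOrder f
  obtain ⟨S, hS⟩ := V.exists_hasOrder g
  exact ⟨max R S, hR.mono (le_max_left _ _), hS.mono (le_max_right _ _)⟩

/-- The iterated total derivative `d_J`. -/
def dJ (J : MultiIndex N) : A →ₗ[ℝ] A where
  toFun := iter (fun i f => V.d i f) J
  map_add' f g := by
    induction J using MultiIndex.induction_on with
    | zero => simp [iter_zero]
    | add_unit J i ih => simp [iter_add_unitIndex _ V.d_comm, ih]
  map_smul' c f := by
    induction J using MultiIndex.induction_on with
    | zero => simp [iter_zero]
    | add_unit J i ih => simp [iter_add_unitIndex _ V.d_comm, ih]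

@[simp]
theorem dJ_zero (f : A) : V.dJ 0 f = f := iter_zero _ _

theorem dJ_add_unitIndex (J : MultiIndex N) (i : Fin N) (f : A) :
    V.dJ (J + unitIndex i) f = V.d i (V.dJ J f) := iter_add_unitIndex _ V.d_comm J i f

theorem dJ_d (J : MultiIndex N) (i : Fin N) (f : A) : V.dJ J (V.d i f) = V.d i (V.dJ J f) := by
  induction J using MultiIndex.induction_on with
  | zero => simp
  | add_unit J j ih => rw [dJ_add_unitIndex, dJ_add_unitIndex, ih, V.d_comm]

/-- The multi-index Leibniz rule, solved for the term in which all derivatives hit `u`. -/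
theorem sum_multiChoose_dJ (K : MultiIndex N) (u b : A) {R : ℕ} (hR : ∑ i, K i ≤ R) :
    ∑ J ∈ multiIndices N R, ((multiChoose K J : ℝ) * (-1) ^ (∑ i, J i)) •
      V.dJ (K - J) (u * V.dJ J b) = V.dJ K u * b := by
  induction K using MultiIndex.induction_on generalizing b R with
  | zero =>
    rw [Finset.sum_eq_single 0]
    · simp [multiChoose_zero_right]
    · intro J _ hJ
      rw [multiChoose_eq_zero]
      · simp
      · intro h
        exact hJ (le_antisymm h zero_le)
    · intro h
      exact absurd (zero_mem_multiIndices N R) h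
  | add_unit K i ih =>
    rw [sum_add_unitIndex] at hR
    obtain ⟨R, rfl⟩ := Nat.exists_eq_add_of_le' (show 1 ≤ R by omega)
    obtain ⟨g, hg⟩ : ∃ g : MultiIndex N → A, g = fun J =>
        -(((multiChoose K J : ℝ) * (-1) ^ (∑ i, J i)) • V.dJ (K - J) (u * V.dJ J (V.d i b))) :=
      ⟨_, rfl⟩
    have hsplit : ∀ J : MultiIndex N,
        ((multiChoose (K + unitIndex i) J : ℝ) * (-1) ^ (∑ i, J i)) •
          V.dJ (K + unitIndex i - J) (u * V.dJ J b) =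
        V.d i (((multiChoose K J : ℝ) * (-1) ^ (∑ i, J i)) • V.dJ (K - J) (u * V.dJ J b)) +
        if J i = 0 then 0 else g (J - unitIndex i) := fun J => by
      rw [multiChoose_add_unitIndex, Nat.cast_add, add_mul, add_smul]
      congr 1
      · by_cases h : J ≤ K
        · rw [tsub_add_eq_add_tsub h |>.symm, dJ_add_unitIndex, Derivation.map_smul]
        · simp [multiChoose_eq_zero h]
      · split_ifs with hi
        · simp
        · have hJ := sub_unitIndex_add hi
          generalize J - unitIndex i = J' at hJ
          subst hJ
          rw [hg, sum_add_unitIndex, add_tsub_add_eq_tsub_right, dJ_add_unitIndex, pow_succ]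
          simp [dJ_d]
    rw [Finset.sum_congr rfl fun J _ => hsplit J, Finset.sum_add_distrib, ← map_sum,
      ih b (by omega), sum_multiIndices_shift, hg, Finset.sum_neg_distrib, ih (V.d i b) (by omega),
      dJ_add_unitIndex, Derivation.leibniz, smul_eq_mul, smul_eq_mul]
    ring

/-- Integration by parts in the form `∑_J (K choose J) (-1)^{|J|} d_J (d_{K-J} a · b) =
(-1)^{|K|} a · d_K b`. -/
theorem sum_multiChoose_dJ' (K : MultiIndex N) (a b : A) {R : ℕ} (hR : ∑ i, K i ≤ R) :
    ∑ J ∈ multiIndices N R, ((multiChoose K J : ℝ) * (-1) ^ (∑ i, J i)) •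
      V.dJ J (V.dJ (K - J) a * b) = ((-1 : ℝ) ^ (∑ i, K i)) • (a * V.dJ K b) := by
  classical
  have hfil : ∀ g : MultiIndex N → A,
      ∑ J ∈ multiIndices N R, (multiChoose K J : ℝ) • g J =
        ∑ J ∈ (multiIndices N R).filter (· ≤ K), (multiChoose K J : ℝ) • g J := fun g => by
    rw [Finset.sum_filter]
    refine Finset.sum_congr rfl fun J _ => ?_
    split_ifs with h
    · rfl
    · simp [multiChoose_eq_zero h]
  have hsum : ∀ J : MultiIndex N, J ≤ K → ∑ i, (K - J) i + ∑ i, J i = ∑ i, K i := fun J hJ => by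
    rw [← Finset.sum_add_distrib]
    exact Finset.sum_congr rfl fun i _ => tsub_add_cancel_of_le (hJ i)
  rw [mul_comm a, ← V.sum_multiChoose_dJ K b a hR, Finset.smul_sum]
  simp_rw [smul_comm ((-1 : ℝ) ^ (∑ i, K i)), mul_smul]
  rw [hfil, hfil]
  have hmem : ∀ J ∈ (multiIndices N R).filter (· ≤ K),
      K - J ∈ (multiIndices N R).filter (· ≤ K) := fun J hJ => by
    simp only [Finset.mem_filter, mem_multiIndices] at *
    have := hsum J hJ.2
    exact ⟨by omega, tsub_le_self⟩
  refine Finset.sum_nbij' (fun J => K - J) (fun J => K - J) hmem hmem ?_ ?_ ?_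
  · intro J hJ
    exact tsub_tsub_cancel_of_le (Finset.mem_filter.mp hJ).2
  · intro J hJ
    exact tsub_tsub_cancel_of_le (Finset.mem_filter.mp hJ).2
  · intro J hJ
    have hJ' := (Finset.mem_filter.mp hJ).2
    rw [multiChoose_sub hJ', tsub_tsub_cancel_of_le hJ', mul_comm b, ← hsum J hJ', smul_smul (_ ^ _),
      pow_add, ← mul_assoc, ← pow_add, Even.neg_one_pow ⟨_, rfl⟩, one_mul]

/-- The Euler operator `f ↦ ∑_J (-1)^{|J|} d_J ∂f/∂y^σ_J`. -/
def euler (σ : Fin m) : A →ₗ[ℝ] A where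
  toFun f := ∑ᶠ J, ((-1 : ℝ) ^ (∑ i, J i)) • V.dJ J (V.pd σ J f)
  map_add' f g := by
    obtain ⟨R, hf, hg⟩ := V.exists_hasOrder₂ f g
    rw [finsum_eq_sum_multiIndices R, finsum_eq_sum_multiIndices R, finsum_eq_sum_multiIndices R]
    · simp [Finset.sum_add_distrib]
    · intro J hJ; simp [hg σ J hJ]
    · intro J hJ; simp [hf σ J hJ]
    · intro J hJ; simp [hf σ J hJ, hg σ J hJ]
  map_smul' c f := by
    obtain ⟨R, hf⟩ := V.exists_hasOrder f
    rw [finsum_eq_sum_multiIndices R, finsum_eq_sum_multiIndices R]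
    · simp only [Derivation.map_smul, map_smul, RingHom.id_apply, Finset.smul_sum]
      exact Finset.sum_congr rfl fun J _ => smul_comm _ _ _
    · intro J hJ; simp [hf σ J hJ]
    · intro J hJ; simp [hf σ J hJ]

variable {V} in
theorem HasOrder.euler_eq {R : ℕ} {f : A} (hf : V.HasOrder R f) (σ : Fin m) :
    V.euler σ f =
      ∑ J ∈ multiIndices N R, ((-1 : ℝ) ^ (∑ i, J i)) • V.dJ J (V.pd σ J f) :=
  finsum_eq_sum_multiIndices R fun J hJ => by simp [hf σ J hJ]

/-- The derivative along the prolongation of the vertical vector field with components `u`. -/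
def prol (u : Fin m → A) : Derivation ℝ A A :=
  Derivation.mk'
    { toFun := fun f => ∑ σ, ∑ᶠ J, V.dJ J (u σ) * V.pd σ J f
      map_add' := fun f g => by
        obtain ⟨R, hf, hg⟩ := V.exists_hasOrder₂ f g
        rw [← Finset.sum_add_distrib]
        refine Finset.sum_congr rfl fun σ _ => ?_
        rw [finsum_eq_sum_multiIndices R, finsum_eq_sum_multiIndices R,
          finsum_eq_sum_multiIndices R]
        · simp [Finset.sum_add_distrib, mul_add]
        · intro J hJ; simp [hg σ J hJ]
        · intro J hJ; simp [hf σ J hJ]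
        · intro J hJ; simp [hf σ J hJ, hg σ J hJ]
      map_smul' := fun c f => by
        obtain ⟨R, hf⟩ := V.exists_hasOrder f
        rw [Finset.smul_sum]
        refine Finset.sum_congr rfl fun σ _ => ?_
        rw [finsum_eq_sum_multiIndices R, finsum_eq_sum_multiIndices R]
        · simp [Finset.smul_sum]
        · intro J hJ; simp [hf σ J hJ]
        · intro J hJ; simp [hf σ J hJ] }
    (fun f g => by
      obtain ⟨R, hf, hg⟩ := V.exists_hasOrder₂ f g
      simp only [LinearMap.coe_mk, AddHom.coe_mk, smul_eq_mul]
      rw [Finset.mul_sum, Finset.mul_sum, ← Finset.sum_add_distrib]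
      refine Finset.sum_congr rfl fun σ _ => ?_
      rw [finsum_eq_sum_multiIndices R, finsum_eq_sum_multiIndices R,
        finsum_eq_sum_multiIndices R, Finset.mul_sum, Finset.mul_sum, ← Finset.sum_add_distrib]
      · refine Finset.sum_congr rfl fun J _ => ?_
        rw [Derivation.leibniz, smul_eq_mul, smul_eq_mul]
        ring
      · intro J hJ; simp [hf σ J hJ]
      · intro J hJ; simp [hg σ J hJ]
      · intro J hJ; simp [hf σ J hJ, hg σ J hJ])

variable {V} in
theorem HasOrder.prol_eq {R : ℕ} {f : A} (hf : V.HasOrder R f) (u : Fin m → A) :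
    V.prol u f = ∑ σ, ∑ J ∈ multiIndices N R, V.dJ J (u σ) * V.pd σ J f := by
  change ∑ σ, ∑ᶠ J, V.dJ J (u σ) * V.pd σ J f = _
  refine Finset.sum_congr rfl fun σ _ => finsum_eq_sum_multiIndices R fun J hJ => ?_
  rw [hf σ J hJ, mul_zero]

/-- The coefficients `z^I_σ` of the residual operator. -/
def zeta (σ : Fin m) (I : MultiIndex N) (f : A) : A :=
  ∑ᶠ J, ((-1 : ℝ) ^ (∑ i, J i) * (multiChoose (I + J) J : ℝ)) • V.dJ J (V.pd σ (I + J) f)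

variable {V} in
theorem HasOrder.zeta_eq {R : ℕ} {f : A} (hf : V.HasOrder R f) (σ : Fin m) (I : MultiIndex N) :
    V.zeta σ I f = ∑ J ∈ multiIndices N R,
      ((-1 : ℝ) ^ (∑ i, J i) * (multiChoose (I + J) J : ℝ)) • V.dJ J (V.pd σ (I + J) f) :=
  finsum_eq_sum_multiIndices R fun J hJ => by
    rw [hf σ (I + J), map_zero, smul_zero]
    simp only [Pi.add_apply, Finset.sum_add_distrib]
    omega

variable {V} in
theorem HasOrder.zeta_eq_zero {R : ℕ} {f : A} (hf : V.HasOrder R f) (σ : Fin m)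
    {I : MultiIndex N} (hI : R < ∑ i, I i) : V.zeta σ I f = 0 := by
  rw [hf.zeta_eq]
  refine Finset.sum_eq_zero fun J _ => ?_
  rw [hf σ (I + J), map_zero, smul_zero]
  simp only [Pi.add_apply, Finset.sum_add_distrib]
  omega

theorem zeta_zero (σ : Fin m) (f : A) : V.zeta σ 0 f = V.euler σ f := by
  obtain ⟨R, hR⟩ := V.exists_hasOrder f
  rw [hR.zeta_eq, hR.euler_eq]
  refine Finset.sum_congr rfl fun J _ => ?_
  have : multiChoose J J = 1 := by simp [multiChoose]
  rw [zero_add, this, Nat.cast_one, mul_one]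

/-- The `j`-th component of the contraction of the momentum of `f ds` with the prolonged vertical
vector field `u`. -/
def mom (u : Fin m → A) (f : A) (j : Fin N) : A :=
  ∑ᶠ I : MultiIndex N, (((I j : ℝ) + 1) / ((∑ i, (I i : ℝ)) + 1)) •
    V.dJ I (∑ σ, V.zeta σ (I + unitIndex j) f * u σ)

variable {V} in
theorem HasOrder.mom_eq {R : ℕ} {f : A} (hf : V.HasOrder R f) (u : Fin m → A) (j : Fin N) :
    V.mom u f j = ∑ I ∈ multiIndices N R, (((I j : ℝ) + 1) / ((∑ i, (I i : ℝ)) + 1)) •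
      V.dJ I (∑ σ, V.zeta σ (I + unitIndex j) f * u σ) :=
  finsum_eq_sum_multiIndices R fun I hI => by
    have h : ∑ σ, V.zeta σ (I + unitIndex j) f * u σ = 0 := Finset.sum_eq_zero fun σ _ => by
      rw [hf.zeta_eq_zero σ, zero_mul]
      rw [sum_add_unitIndex]
      omega
    rw [h, map_zero, smul_zero]

/-- Higher-order form of the prolonged derivative: `∑_J d_J u · ∂f/∂y_J = ∑_I d_I (z^I u)`. -/
theorem HasOrder.prol_eq_sum_zeta {V : JetAlgebra N m A} {R : ℕ} {f : A} (hf : V.HasOrder R f)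
    (u : Fin m → A) :
    V.prol u f = ∑ I ∈ multiIndices N R, V.dJ I (∑ σ, V.zeta σ I f * u σ) := by
  simp_rw [map_sum]
  rw [hf.prol_eq, Finset.sum_comm (s := multiIndices N R)]
  refine Finset.sum_congr rfl fun σ _ => ?_
  have h1 : ∀ I ∈ multiIndices N R, V.dJ I (V.zeta σ I f * u σ) =
      ∑ J ∈ multiIndices N R, ((multiChoose (I + J) J : ℝ) * (-1) ^ (∑ i, J i)) •
        V.dJ I (u σ * V.dJ J (V.pd σ (I + J) f)) := fun I _ => by
    rw [hf.zeta_eq, Finset.sum_mul, map_sum]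
    refine Finset.sum_congr rfl fun J _ => ?_
    rw [smul_mul_assoc, map_smul, mul_comm (u σ), mul_comm ((-1 : ℝ) ^ _)]
  have h2 : ∀ K ∈ multiIndices N R, V.dJ K (u σ) * V.pd σ K f = _ := fun K hK =>
    (V.sum_multiChoose_dJ K (u σ) (V.pd σ K f) (mem_multiIndices.mp hK)).symm
  rw [Finset.sum_congr rfl h1, Finset.sum_congr rfl h2]
  conv_rhs => rw [Finset.sum_comm]
  conv_lhs => rw [Finset.sum_comm]
  symm
  refine Finset.sum_congr rfl fun J _ => ?_
  rw [sum_multiIndices_add R J fun K I => ((multiChoose K J : ℝ) * (-1) ^ (∑ i, J i)) •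
        V.dJ I (u σ * V.dJ J (V.pd σ K f))]
  · refine Finset.sum_congr rfl fun K _ => ?_
    split_ifs with h
    · rfl
    · simp [multiChoose_eq_zero h]
  · intro K I hK
    simp [hf σ K hK]

/-- A sum `∑_I d_I f^I` is `f^0` plus the divergence of the `∑_I (I_j+1)/(|I|+1) d_I f^{I+e_j}`. -/
theorem sum_dJ_eq_add_divergence {R : ℕ} (F : MultiIndex N → A)
    (hF : ∀ I, R < ∑ i, I i → F I = 0) :
    ∑ I ∈ multiIndices N R, V.dJ I (F I) = F 0 +
      ∑ j, V.d j (∑ I ∈ multiIndices N R, (((I j : ℝ) + 1) / ((∑ i, (I i : ℝ)) + 1)) •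
        V.dJ I (F (I + unitIndex j))) := by
  have h1 : ∀ I : MultiIndex N, V.dJ I (F I) = (if I = 0 then F 0 else 0) +
      ∑ j, ((I j : ℝ) / ∑ i, (I i : ℝ)) • V.dJ I (F I) := fun I => by
    rw [← Finset.sum_smul, ← Finset.sum_div]
    split_ifs with h
    · subst h
      simp
    · rw [div_self, one_smul, zero_add]
      intro h0
      apply h
      funext i
      have := (Finset.sum_eq_zero_iff_of_nonneg fun i _ => Nat.cast_nonneg (I i)).mp h0 i
        (Finset.mem_univ i)
      exact_mod_cast this
  have h2 : ∀ j, V.d j (∑ I ∈ multiIndices N R, (((I j : ℝ) + 1) / ((∑ i, (I i : ℝ)) + 1)) •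
        V.dJ I (F (I + unitIndex j))) =
      ∑ I ∈ multiIndices N R, ((I j : ℝ) / ∑ i, (I i : ℝ)) • V.dJ I (F I) := fun j => by
    rw [map_sum, ← sum_multiIndices_shift R j]
    rw [← sum_multiIndices_of_le (Nat.le_succ R)]
    · refine Finset.sum_congr rfl fun I _ => ?_
      split_ifs with h
      · simp [h]
      · have hI := sub_unitIndex_add h
        generalize I - unitIndex j = I' at hI
        subst hI
        have : ∑ i, ((I' + unitIndex j) i : ℝ) = ∑ i, (I' i : ℝ) + 1 := by
          exact_mod_cast sum_add_unitIndex I' j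
        rw [this, Derivation.map_smul, dJ_add_unitIndex]
        simp [unitIndex]
    · intro I hI
      rw [hF I hI, map_zero, smul_zero]
  rw [Finset.sum_congr rfl fun I _ => h1 I, Finset.sum_add_distrib, Finset.sum_comm,
    Finset.sum_ite_eq', if_pos (zero_mem_multiIndices N R)]
  simp_rw [h2]

/-- The first variation formula. -/
theorem divergence_mom (u : Fin m → A) (f : A) :
    ∑ j, V.d j (V.mom u f j) = V.prol u f - ∑ σ, u σ * V.euler σ f := by
  obtain ⟨R, hf⟩ := V.exists_hasOrder f
  have hz : ∀ I, R < ∑ i, I i → ∑ σ, V.zeta σ I f * u σ = 0 := fun I hI =>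
    Finset.sum_eq_zero fun σ _ => by rw [hf.zeta_eq_zero σ hI, zero_mul]
  rw [hf.prol_eq_sum_zeta, V.sum_dJ_eq_add_divergence _ hz]
  simp_rw [hf.mom_eq, zeta_zero, mul_comm (u _)]
  abel

/-- The Euler operator annihilates total derivatives. -/
theorem euler_d (σ : Fin m) (i : Fin N) (f : A) : V.euler σ (V.d i f) = 0 := by
  obtain ⟨R, hf⟩ := V.exists_hasOrder f
  obtain ⟨g, hg⟩ : ∃ g : MultiIndex N → A, g = fun J =>
    -(((-1 : ℝ) ^ (∑ i, J i)) • V.d i (V.dJ J (V.pd σ J f))) := ⟨_, rfl⟩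
  have h : ∀ J : MultiIndex N, ((-1 : ℝ) ^ (∑ i, J i)) • V.dJ J (V.pd σ J (V.d i f)) =
      ((-1 : ℝ) ^ (∑ i, J i)) • V.d i (V.dJ J (V.pd σ J f)) +
      if J i = 0 then 0 else g (J - unitIndex i) := fun J => by
      rw [V.pd_d, map_add, smul_add, dJ_d]
      congr 1
      split_ifs with hi
      · simp
      · have hJ := sub_unitIndex_add hi
        generalize J - unitIndex i = J' at hJ
        subst hJ
        rw [hg, sum_add_unitIndex, dJ_add_unitIndex, pow_succ]
        simp
  rw [(hf.d i).euler_eq, Finset.sum_congr rfl fun J _ => h J, Finset.sum_add_distrib,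
    sum_multiIndices_shift, sum_multiIndices_of_le (Nat.le_succ R), hg, Finset.sum_neg_distrib,
    add_neg_cancel]
  intro J hJ
  simp [hf σ J hJ]

/-- Prolonged vertical vector fields commute with total derivatives. -/
theorem prol_d (u : Fin m → A) (i : Fin N) (f : A) :
    V.prol u (V.d i f) = V.d i (V.prol u f) := by
  obtain ⟨R, hf⟩ := V.exists_hasOrder f
  rw [hf.prol_eq, (hf.d i).prol_eq, map_sum]
  refine Finset.sum_congr rfl fun σ _ => ?_
  obtain ⟨g, hg⟩ : ∃ g : MultiIndex N → A, g = fun J =>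
    V.d i (V.dJ J (u σ)) * V.pd σ J f := ⟨_, rfl⟩
  have h : ∀ J : MultiIndex N, V.dJ J (u σ) * V.pd σ J (V.d i f) =
      V.dJ J (u σ) * V.d i (V.pd σ J f) +
      if J i = 0 then 0 else g (J - unitIndex i) := fun J => by
    rw [V.pd_d, mul_add]
    congr 1
    split_ifs with hi
    · simp
    · simp only [hg]
      rw [← dJ_add_unitIndex, sub_unitIndex_add hi]
  rw [Finset.sum_congr rfl fun J _ => h J, Finset.sum_add_distrib,
    sum_multiIndices_shift, sum_multiIndices_of_le (Nat.le_succ R), hg, ← Finset.sum_add_distrib,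
    map_sum]
  · refine Finset.sum_congr rfl fun J _ => ?_
    rw [Derivation.leibniz, smul_eq_mul, smul_eq_mul]
    ring
  · intro J hJ
    simp [hf σ J hJ]

theorem prol_dJ (u : Fin m → A) (J : MultiIndex N) (f : A) :
    V.prol u (V.dJ J f) = V.dJ J (V.prol u f) := by
  induction J using MultiIndex.induction_on with
  | zero => simp
  | add_unit J i ih => rw [dJ_add_unitIndex, dJ_add_unitIndex, prol_d, ih]

/-- Partial derivatives of total derivatives of a function on the total space. -/
theorem HasOrder.pd_dJ {V : JetAlgebra N m A} {f : A} (hf : V.HasOrder 0 f) (σ : Fin m)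
    (J K : MultiIndex N) :
    V.pd σ J (V.dJ K f) = (multiChoose K J : ℝ) • V.dJ (K - J) (V.pd σ 0 f) := by
  induction K using MultiIndex.induction_on generalizing J with
  | zero =>
    by_cases h : J = 0
    · subst h
      simp [multiChoose_zero_right]
    · rw [multiChoose_eq_zero, dJ_zero, hf]
      · simp
      · by_contra hc
        apply h
        funext i
        have := (Finset.sum_eq_zero_iff.mp (Nat.le_zero.mp (not_lt.mp hc))) i (Finset.mem_univ i)
        simpa using this
      · intro hc
        exact h (le_antisymm hc zero_le)
  | add_unit K i ih =>
    rw [dJ_add_unitIndex, V.pd_d, ih, multiChoose_add_unitIndex, Nat.cast_add, add_smul]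
    congr 1
    · by_cases h : J ≤ K
      · rw [tsub_add_eq_add_tsub h |>.symm, dJ_add_unitIndex, Derivation.map_smul]
      · simp [multiChoose_eq_zero h]
    · split_ifs with hi
      · simp
      · rw [ih]
        congr 2
        conv_rhs => rw [← sub_unitIndex_add hi]
        rw [add_tsub_add_eq_tsub_right]

/-- The Euler operator is natural under prolonged vector fields of the total space. -/
theorem euler_prol {ξ : Fin m → A} (hξ : ∀ ν, V.HasOrder 0 (ξ ν)) (σ : Fin m) (f : A) :
    V.euler σ (V.prol ξ f) =
      V.prol ξ (V.euler σ f) + ∑ ν, V.pd σ 0 (ξ ν) * V.euler ν f := by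
  obtain ⟨R, hf, hp⟩ := V.exists_hasOrder₂ f (V.prol ξ f)
  have h1 : ∀ J, V.pd σ J (V.prol ξ f) = V.prol ξ (V.pd σ J f) +
      ∑ ν, ∑ K ∈ multiIndices N R,
        ((multiChoose K J : ℝ) • V.dJ (K - J) (V.pd σ 0 (ξ ν))) * V.pd ν K f := fun J => by
    rw [(hf.pd σ J).prol_eq, hf.prol_eq, map_sum, ← Finset.sum_add_distrib]
    refine Finset.sum_congr rfl fun ν _ => ?_
    rw [map_sum, ← Finset.sum_add_distrib]
    refine Finset.sum_congr rfl fun K _ => ?_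
    rw [Derivation.leibniz, smul_eq_mul, smul_eq_mul, (hξ ν).pd_dJ, V.pd_comm, mul_comm (V.pd ν K f)]
  rw [hp.euler_eq, hf.euler_eq σ, map_sum]
  simp_rw [h1, map_add, smul_add, Derivation.map_smul, prol_dJ]
  rw [Finset.sum_add_distrib]
  congr 1
  simp_rw [map_sum, Finset.smul_sum]
  rw [Finset.sum_comm]
  refine Finset.sum_congr rfl fun ν _ => ?_
  rw [Finset.sum_comm, hf.euler_eq, Finset.mul_sum]
  refine Finset.sum_congr rfl fun K hK => ?_
  rw [mul_smul_comm, ← V.sum_multiChoose_dJ' K _ _ (mem_multiIndices.mp hK)]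
  refine Finset.sum_congr rfl fun J _ => ?_
  rw [smul_mul_assoc, map_smul, smul_smul, mul_comm]

/-- The prolongation acts on functions on the total space through their first derivatives. -/
theorem HasOrder.prol_eq_zero_order {V : JetAlgebra N m A} {f : A} (hf : V.HasOrder 0 f)
    (u : Fin m → A) : V.prol u f = ∑ σ, u σ * V.pd σ 0 f := by
  rw [hf.prol_eq]
  have : multiIndices N 0 = {0} := by
    ext J
    rw [mem_multiIndices, Finset.mem_singleton, Nat.le_zero, Finset.sum_eq_zero_iff]
    simp [funext_iff]
  simp [this]

/-- The algebraic content of the second variation: the commutation of successive variations along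
vector fields `ξ`, `η` of the total space, with bracket components `prol η ξ - prol ξ η`. -/
theorem second_variation {ξ η : Fin m → A} (hη : ∀ ν, V.HasOrder 0 (η ν)) (f : A) :
    (∑ σ, ξ σ * V.euler σ (∑ ν, η ν * V.euler ν f)) +
        ∑ ν, (V.prol η (ξ ν) - V.prol ξ (η ν)) * V.euler ν f =
      (∑ σ, η σ * V.euler σ (∑ ν, ξ ν * V.euler ν f)) +
        ∑ j, V.d j (V.mom η (∑ ν, ξ ν * V.euler ν f) j) := by
  have h1 : ∀ σ, V.euler σ (∑ ν, η ν * V.euler ν f) = V.euler σ (V.prol η f) := fun σ => by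
    have h := V.divergence_mom η f
    rw [eq_sub_iff_add_eq, ← eq_sub_iff_add_eq'] at h
    rw [h, map_sub, map_sum]
    simp [euler_d]
  rw [divergence_mom, add_sub_cancel, map_sum]
  simp_rw [h1, V.euler_prol hη, Derivation.leibniz, smul_eq_mul, (hη _).prol_eq_zero_order,
    mul_add, sub_mul, Finset.sum_add_distrib, Finset.sum_sub_distrib, Finset.mul_sum,
    Finset.sum_mul]
  rw [Finset.sum_comm (f := fun ν σ => ξ σ * V.pd σ 0 (η ν) * V.euler ν f)]
  simp_rw [mul_assoc, mul_comm (V.euler _ f) (V.prol _ _)]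
  abel

/-- The exchange formulas for `(ξ, η)` and `(η, ξ)` add up, the brackets cancelling. -/
theorem divergence_mom_antisymm {ξ η : Fin m → A} (hξ : ∀ ν, V.HasOrder 0 (ξ ν))
    (hη : ∀ ν, V.HasOrder 0 (η ν)) (f : A) :
    (∑ j, V.d j (V.mom η (∑ ν, ξ ν * V.euler ν f) j)) +
      ∑ j, V.d j (V.mom ξ (∑ ν, η ν * V.euler ν f) j) = 0 := by
  have h1 := V.second_variation (ξ := ξ) hη f
  have h2 := V.second_variation (ξ := η) hξ f
  have h3 : ∑ ν, (V.prol ξ (η ν) - V.prol η (ξ ν)) * V.euler ν f =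
      -∑ ν, (V.prol η (ξ ν) - V.prol ξ (η ν)) * V.euler ν f := by
    rw [← Finset.sum_neg_distrib]
    exact Finset.sum_congr rfl fun ν _ => by ring
  rw [h3] at h2
  linear_combination -h1 - h2

end JetAlgebra

/-! ### Smooth functions of finite order -/

section JetFunctions

open TopologicalSpace

variable {N m : ℕ}

/-- The coordinate jets over an open set of the total space. -/
def jetSet (O : Opens (TotalModel N m)) : Set (Jet N m) := {p | basePoint p ∈ O}

/-- The coordinate jets of order `r` over an open set of the total space. -/
def finJetSet (O : Opens (TotalModel N m)) (r : ℕ) : Set (FinJet N m r) :=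
  {p | (p.1, fun σ => p.2 σ ⟨0, zero_mem_multiIndices N r⟩) ∈ O}

/-- The projection from the jets of order `s` to those of order `r ≤ s`. -/
def restrictJet {r s : ℕ} (h : r ≤ s) : FinJet N m s →L[ℝ] FinJet N m r where
  toFun p := (p.1, fun σ J => p.2 σ ⟨J, mem_multiIndices.mpr ((mem_multiIndices.mp J.2).trans h)⟩)
  map_add' _ _ := rfl
  map_smul' _ _ := rfl
  cont := by fun_prop

theorem truncate_add (r : ℕ) (p q : Jet N m) :
    truncate r (p + q) = truncate r p + truncate r q := rfl

theorem truncate_smul (r : ℕ) (c : ℝ) (p : Jet N m) :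
    truncate r (c • p) = c • truncate r p := rfl

theorem truncate_zero (r : ℕ) : truncate r (0 : Jet N m) = 0 := rfl

theorem restrictJet_truncate {r s : ℕ} (h : r ≤ s) (p : Jet N m) :
    restrictJet h (truncate s p) = truncate r p := rfl

variable (O : Opens (TotalModel N m))

theorem isOpen_finJetSet (r : ℕ) : IsOpen (finJetSet O r) := by
  apply O.isOpen.preimage
  fun_prop

variable {O}

theorem truncate_mem {r : ℕ} {p : Jet N m} (hp : p ∈ jetSet O) : truncate r p ∈ finJetSet O r := hp

theorem eventually_add_smul_mem {p : Jet N m} (hp : p ∈ jetSet O) (v : Jet N m) :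
    ∀ᶠ t : ℝ in nhds 0, p + t • v ∈ jetSet O := by
  have hc : Continuous fun t : ℝ => basePoint (p + t • v) := by
    unfold basePoint
    fun_prop
  apply hc.continuousAt.eventually_mem
  apply O.isOpen.mem_nhds
  rw [zero_smul, add_zero]
  exact hp

variable (O)

/-- `F` is, over `O`, the pull-back of the smooth function `g` on the jets of order `r`. -/
def IsPullBack (r : ℕ) (g : FinJet N m r → ℝ) (F : Jet N m → ℝ) : Prop :=
  ContDiffOn ℝ ∞ g (finJetSet O r) ∧ ∀ p ∈ jetSet O, F p = g (truncate r p)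

variable {O}

theorem IsPullBack.differentiableAt {r : ℕ} {g : FinJet N m r → ℝ} {F : Jet N m → ℝ}
    (h : IsPullBack O r g F) {p : Jet N m} (hp : p ∈ jetSet O) :
    DifferentiableAt ℝ g (truncate r p) :=
  (h.1.contDiffAt ((isOpen_finJetSet O r).mem_nhds (truncate_mem hp))).differentiableAt (by simp)

theorem IsPullBack.hasLineDerivAt {r : ℕ} {g : FinJet N m r → ℝ} {F : Jet N m → ℝ}
    (h : IsPullBack O r g F) {p : Jet N m} (hp : p ∈ jetSet O) (v : Jet N m) :
    HasLineDerivAt ℝ F (fderiv ℝ g (truncate r p) (truncate r v)) p v := by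
  have h1 := (h.differentiableAt hp).hasFDerivAt.hasLineDerivAt (truncate r v)
  unfold HasLineDerivAt at *
  refine h1.congr_of_eventuallyEq ?_
  filter_upwards [eventually_add_smul_mem hp v] with t ht
  rw [h.2 _ ht, truncate_add, truncate_smul]

variable (O)

/-- The algebra of smooth functions of finite order on the jets over `O`. -/
def jetFunctions : Subalgebra ℝ (jetSet O → ℝ) where
  carrier := {f | ∃ r, ∃ g : FinJet N m r → ℝ, ContDiffOn ℝ ∞ g (finJetSet O r) ∧
    ∀ p : jetSet O, f p = g (truncate r p)}
  mul_mem' := by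
    rintro f₁ f₂ ⟨r₁, g₁, hg₁, h₁⟩ ⟨r₂, g₂, hg₂, h₂⟩
    refine ⟨max r₁ r₂, fun q => g₁ (restrictJet (le_max_left _ _) q) *
      g₂ (restrictJet (le_max_right _ _) q), ?_, fun p => ?_⟩
    · exact (hg₁.comp (restrictJet (le_max_left r₁ r₂)).contDiff.contDiffOn fun _ hq => hq).mul
        (hg₂.comp (restrictJet (le_max_right r₁ r₂)).contDiff.contDiffOn fun _ hq => hq)
    · rw [Pi.mul_apply, h₁, h₂]
      rfl
  add_mem' := by
    rintro f₁ f₂ ⟨r₁, g₁, hg₁, h₁⟩ ⟨r₂, g₂, hg₂, h₂⟩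
    refine ⟨max r₁ r₂, fun q => g₁ (restrictJet (le_max_left _ _) q) +
      g₂ (restrictJet (le_max_right _ _) q), ?_, fun p => ?_⟩
    · exact (hg₁.comp (restrictJet (le_max_left r₁ r₂)).contDiff.contDiffOn fun _ hq => hq).add
        (hg₂.comp (restrictJet (le_max_right r₁ r₂)).contDiff.contDiffOn fun _ hq => hq)
    · rw [Pi.add_apply, h₁, h₂]
      rfl
  algebraMap_mem' c := ⟨0, fun _ => c, contDiffOn_const, fun _ => rfl⟩

/-- A smooth function of finite order on the jets over `O`. -/
abbrev JetFun : Type := jetFunctions O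

variable {O}

/-- `F` agrees with `f` over `O`. The values of `F` elsewhere are immaterial. -/
def Represents (F : Jet N m → ℝ) (f : JetFun O) : Prop := ∀ p : jetSet O, F p = f.1 p

theorem IsPullBack.exists_represents {r : ℕ} {g : FinJet N m r → ℝ} {F : Jet N m → ℝ}
    (h : IsPullBack O r g F) : ∃ f : JetFun O, Represents F f :=
  ⟨⟨fun p => F p, r, g, h.1, fun p => h.2 p p.2⟩, fun _ => rfl⟩

theorem Represents.exists_isPullBack {F : Jet N m → ℝ} {f : JetFun O} (h : Represents F f) :
    ∃ r g, IsPullBack O r g F := by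
  obtain ⟨r, g, hg, hf⟩ := f.2
  exact ⟨r, g, hg, fun p hp => (h ⟨p, hp⟩).trans (hf ⟨p, hp⟩)⟩

open Classical in
/-- The extension by zero. -/
def JetFun.extend (f : JetFun O) (p : Jet N m) : ℝ := if h : p ∈ jetSet O then f.1 ⟨p, h⟩ else 0

theorem JetFun.represents_extend (f : JetFun O) : Represents f.extend f := fun p => by
  simp [JetFun.extend]

theorem Represents.add {F G : Jet N m → ℝ} {f g : JetFun O} (hF : Represents F f)
    (hG : Represents G g) : Represents (fun p => F p + G p) (f + g) := fun p => by
  dsimp only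
  rw [hF, hG]
  rfl

theorem Represents.mul {F G : Jet N m → ℝ} {f g : JetFun O} (hF : Represents F f)
    (hG : Represents G g) : Represents (fun p => F p * G p) (f * g) := fun p => by
  dsimp only
  rw [hF, hG]
  rfl

theorem Represents.smul {F : Jet N m → ℝ} {f : JetFun O} (hF : Represents F f) (c : ℝ) :
    Represents (fun p => c * F p) (c • f) := fun p => by
  dsimp only
  rw [hF]
  rfl

theorem JetFun.coe_sum {ι : Type*} (s : Finset ι) (f : ι → JetFun O) (p : jetSet O) :
    (∑ i ∈ s, f i).1 p = ∑ i ∈ s, (f i).1 p := by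
  simp

theorem Represents.eq {F G : Jet N m → ℝ} {f : JetFun O} (hF : Represents F f)
    (hG : Represents G f) : ∀ p ∈ jetSet O, F p = G p := fun p hp =>
  (hF ⟨p, hp⟩).trans (hG ⟨p, hp⟩).symm

theorem Represents.eq_of_eq {F G : Jet N m → ℝ} {f g : JetFun O} (hF : Represents F f)
    (hG : Represents G g) (h : ∀ p ∈ jetSet O, F p = G p) : f = g :=
  Subtype.ext (funext fun p => (hF p).symm.trans ((h p p.2).trans (hG p)))

/-- On smooth functions of finite order, the derivative is linear in the direction. -/
theorem Represents.exists_linear {F : Jet N m → ℝ} {f : JetFun O} (h : Represents F f)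
    {p : Jet N m} (hp : p ∈ jetSet O) :
    ∃ L : Jet N m →ₗ[ℝ] ℝ, ∀ v, HasLineDerivAt ℝ F (L v) p v := by
  obtain ⟨r, g, hg⟩ := h.exists_isPullBack
  exact ⟨{ toFun := fun v => fderiv ℝ g (truncate r p) (truncate r v)
           map_add' := fun v w => by rw [truncate_add, map_add]
           map_smul' := fun c v => by rw [truncate_smul, map_smul]; rfl },
    fun v => hg.hasLineDerivAt hp v⟩

theorem lineDeriv_congr {F G : Jet N m → ℝ} (h : ∀ p ∈ jetSet O, F p = G p) {p : Jet N m}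
    (hp : p ∈ jetSet O) (v : Jet N m) : lineDeriv ℝ F p v = lineDeriv ℝ G p v := by
  unfold lineDeriv
  apply Filter.EventuallyEq.deriv_eq
  filter_upwards [eventually_add_smul_mem hp v] with t ht
  exact h _ ht

/-- A vector field whose components of order at most `r` are smooth functions of finite order. -/
def IsAdmissible (V : JetField N m) : Prop :=
  ∀ r, ∃ s, r ≤ s ∧ ∃ G : FinJet N m s → FinJet N m r,
    ContDiff ℝ ∞ G ∧ ∀ p, truncate r (V p) = G (truncate s p)

theorem isAdmissible_totalVec (i : Fin N) : IsAdmissible (totalVec i : JetField N m) := fun r =>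
  ⟨r + 1, Nat.le_succ r, fun q => (Pi.single i 1, fun σ J => q.2 σ ⟨J + unitIndex i, by
    rw [mem_multiIndices, sum_add_unitIndex]
    exact Nat.succ_le_succ (mem_multiIndices.mp J.2)⟩), by fun_prop, fun _ => rfl⟩

theorem isAdmissible_partialY (σ : Fin m) (J : MultiIndex N) :
    IsAdmissible (partialY σ J) := fun r =>
  ⟨r, le_rfl, fun _ => truncate r (partialY σ J 0), contDiff_const, fun _ => rfl⟩

/-- The derivative of a smooth function of finite order along a vector field. -/
def alongFun (V : JetField N m) (hV : IsAdmissible V) (f : JetFun O) : JetFun O :=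
  ⟨fun p => lineDeriv ℝ f.extend p (V p), by
    obtain ⟨r, g, hg⟩ := f.represents_extend.exists_isPullBack
    obtain ⟨s, hrs, G, hG, hVG⟩ := hV r
    refine ⟨s, fun q => fderiv ℝ g (restrictJet hrs q) (G q), ?_, fun p => ?_⟩
    · refine ContDiffOn.clm_apply ?_ hG.contDiffOn
      exact (hg.1.fderiv_of_isOpen (isOpen_finJetSet O r) (by simp)).comp
        (restrictJet hrs).contDiff.contDiffOn fun _ hq => hq
    · dsimp only
      rw [(hg.hasLineDerivAt p.2 _).lineDeriv, hVG, restrictJet_truncate]⟩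

theorem Represents.alongFun {F : Jet N m → ℝ} {f : JetFun O} (h : Represents F f)
    (V : JetField N m) (hV : IsAdmissible V) :
    Represents (fun p => lineDeriv ℝ F p (V p)) (alongFun V hV f) := fun p =>
  lineDeriv_congr (h.eq f.represents_extend) p.2 _

/-- The derivation of the algebra of smooth functions of finite order along a vector field. -/
def along (V : JetField N m) (hV : IsAdmissible V) : Derivation ℝ (JetFun O) (JetFun O) :=
  Derivation.mk'
    { toFun := alongFun V hV
      map_add' := fun f g => by
        have hf := f.represents_extend
        have hg := g.represents_extend
        refine ((hf.add hg).alongFun V hV).eq_of_eq ((hf.alongFun V hV).add (hg.alongFun V hV))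
          fun p hp => ?_
        obtain ⟨L, hL⟩ := hf.exists_linear hp
        obtain ⟨L', hL'⟩ := hg.exists_linear hp
        rw [(hL _).lineDeriv, (hL' _).lineDeriv]
        exact HasLineDerivAt.lineDeriv (HasDerivAt.add (hL (V p)) (hL' (V p)))
      map_smul' := fun c f => by
        have hf := f.represents_extend
        refine ((hf.smul c).alongFun V hV).eq_of_eq ((hf.alongFun V hV).smul c) fun p hp => ?_
        obtain ⟨L, hL⟩ := hf.exists_linear hp
        rw [(hL _).lineDeriv]
        exact HasLineDerivAt.lineDeriv (HasDerivAt.const_mul c (hL (V p))) }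
    (fun f g => by
      have hf := f.represents_extend
      have hg := g.represents_extend
      refine ((hf.mul hg).alongFun V hV).eq_of_eq ((hf.mul (hg.alongFun V hV)).add
        (hg.mul (hf.alongFun V hV))) fun p hp => ?_
      obtain ⟨L, hL⟩ := hf.exists_linear hp
      obtain ⟨L', hL'⟩ := hg.exists_linear hp
      rw [(hL _).lineDeriv, (hL' _).lineDeriv]
      have h := HasDerivAt.mul (hL (V p)) (hL' (V p))
      simp only [zero_smul, add_zero] at h
      rw [mul_comm (g.extend p), add_comm (_ * _)]
      exact HasLineDerivAt.lineDeriv h)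

theorem Represents.along {F : Jet N m → ℝ} {f : JetFun O} (h : Represents F f) (V : JetField N m)
    (hV : IsAdmissible V) :
    Represents (fun p => lineDeriv ℝ F p (V p)) (along V hV f) := h.alongFun V hV

/-- The second derivative along vector fields, the first of which is affine with linear part
`B`. -/
theorem IsPullBack.along_along {r : ℕ} {g : FinJet N m r → ℝ} {F : Jet N m → ℝ} {f : JetFun O}
    (hg : IsPullBack O r g F) (hF : Represents F f) {V W : JetField N m} (hV : IsAdmissible V)
    (hW : IsAdmissible W) {B : Jet N m → Jet N m}
    (hB : ∀ p w (t : ℝ), V (p + t • w) = V p + t • B w) (p : jetSet O) :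
    (along W hW (along V hV f)).1 p =
      fderiv ℝ (fderiv ℝ g) (truncate r p) (truncate r (W p)) (truncate r (V p)) +
        fderiv ℝ g (truncate r p) (truncate r (B (W p))) := by
  rw [← (hF.along V hV).along W hW p]
  have h1 : DifferentiableAt ℝ (fderiv ℝ g) (truncate r p.1) := by
    have h2 := hg.1.fderiv_of_isOpen (m := ∞) (isOpen_finJetSet O r) (by simp)
    exact (h2.contDiffAt ((isOpen_finJetSet O r).mem_nhds (truncate_mem p.2))).differentiableAt
      (by simp)
  have h2 : HasDerivAt (fun t : ℝ => fderiv ℝ g (truncate r p.1 + t • truncate r (W p)))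
      (fderiv ℝ (fderiv ℝ g) (truncate r p) (truncate r (W p))) 0 :=
    h1.hasFDerivAt.hasLineDerivAt (truncate r (W p))
  have h3 : HasDerivAt (fun t : ℝ => truncate r (V p) + t • truncate r (B (W p)))
      (truncate r (B (W p))) 0 := by
    simpa using ((hasDerivAt_id (0 : ℝ)).smul_const (truncate r (B (W p)))).const_add
      (truncate r (V p))
  have h4 := h2.clm_apply h3
  simp only [zero_smul, add_zero] at h4
  apply HasLineDerivAt.lineDeriv
  unfold HasLineDerivAt
  refine h4.congr_of_eventuallyEq ?_
  filter_upwards [eventually_add_smul_mem p.2 (W p)] with t ht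
  rw [(hg.hasLineDerivAt ht _).lineDeriv, hB]
  rfl

theorem IsPullBack.second_fderiv_symm {r : ℕ} {g : FinJet N m r → ℝ} {F : Jet N m → ℝ}
    (hg : IsPullBack O r g F) (p : jetSet O) (v w : FinJet N m r) :
    fderiv ℝ (fderiv ℝ g) (truncate r p) v w = fderiv ℝ (fderiv ℝ g) (truncate r p) w v :=
  (hg.1.contDiffAt ((isOpen_finJetSet O r).mem_nhds (truncate_mem p.2))).isSymmSndFDerivAt
    (by simpa using WithTop.coe_le_coe.2 (le_top : (2 : ℕ∞) ≤ ⊤)) v w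

/-- The linear part of the affine vector field `totalVec i`. -/
def shiftJet (i : Fin N) (v : Jet N m) : Jet N m := (0, fun σ J => v.2 σ (J + unitIndex i))

theorem totalVec_add_smul (i : Fin N) (p w : Jet N m) (t : ℝ) :
    totalVec i (p + t • w) = totalVec i p + t • shiftJet i w := by
  unfold totalVec shiftJet
  ext <;> simp

theorem partialY_add_smul (σ : Fin m) (J : MultiIndex N) (p w : Jet N m) (t : ℝ) :
    partialY σ J (p + t • w) = partialY σ J p + t • (0 : Jet N m) := by
  simp [partialY]

theorem shiftJet_partialY (i : Fin N) (σ : Fin m) (J : MultiIndex N) (p : Jet N m) :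
    shiftJet i (partialY σ J p) = if J i = 0 then 0 else partialY σ (J - unitIndex i) p := by
  have key : ∀ K : MultiIndex N, K + unitIndex i = J ↔ J i ≠ 0 ∧ K = J - unitIndex i := fun K =>
    ⟨fun h => by
      subst h
      exact ⟨by simp [unitIndex], (add_unitIndex_sub K i).symm⟩,
    fun h => by rw [h.2, sub_unitIndex_add h.1]⟩
  refine Prod.ext ?_ ?_
  · split_ifs <;> rfl
  · funext τ K
    by_cases hτ : τ = σ
    · subst hτ
      split_ifs with h <;>
        simp [shiftJet, partialY, Pi.single_apply, key, h]
    · split_ifs <;> simp [shiftJet, partialY, hτ]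

theorem truncate_partialY_eq_zero {r : ℕ} (σ : Fin m) {J : MultiIndex N} (hJ : r < ∑ i, J i)
    (p : Jet N m) : truncate r (partialY σ J p) = 0 := by
  refine Prod.ext rfl (funext fun τ => funext fun K => ?_)
  have hK : K.1 ≠ J := fun h => by
    have := mem_multiIndices.mp K.2
    rw [h] at this
    omega
  by_cases hτ : τ = σ
  · subst hτ
    simp [truncate, partialY, hK]
  · simp [truncate, partialY, hτ]

variable (O)

/-- The smooth functions of finite order on the jets over `O`, with the total derivatives and the
partial derivatives along the fibre coordinates. -/
def jetAlgebra : JetAlgebra N m (JetFun O) where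
  d i := along (totalVec i) (isAdmissible_totalVec i)
  pd σ J := along (partialY σ J) (isAdmissible_partialY σ J)
  d_comm i j f := by
    obtain ⟨r, g, hg⟩ := f.represents_extend.exists_isPullBack
    refine Subtype.ext (funext fun p => ?_)
    rw [hg.along_along f.represents_extend _ _ (totalVec_add_smul j),
      hg.along_along f.represents_extend _ _ (totalVec_add_smul i), hg.second_fderiv_symm]
    have h : shiftJet j (totalVec i p.1) = shiftJet i (totalVec j p.1) := by
      unfold shiftJet totalVec
      simp only [add_right_comm]
    rw [h]
  pd_comm σ J τ K f := by
    obtain ⟨r, g, hg⟩ := f.represents_extend.exists_isPullBack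
    refine Subtype.ext (funext fun p => ?_)
    rw [hg.along_along f.represents_extend _ _ (partialY_add_smul τ K),
      hg.along_along f.represents_extend _ _ (partialY_add_smul σ J), hg.second_fderiv_symm]
  pd_d σ J i f := by
    obtain ⟨r, g, hg⟩ := f.represents_extend.exists_isPullBack
    refine Subtype.ext (funext fun p => ?_)
    rw [hg.along_along f.represents_extend _ _ (totalVec_add_smul i), shiftJet_partialY,
      hg.second_fderiv_symm]
    change _ = (along (totalVec i) (isAdmissible_totalVec i)
      (along (partialY σ J) (isAdmissible_partialY σ J) f)).1 p + _
    rw [hg.along_along f.represents_extend _ _ (partialY_add_smul σ J), truncate_zero, map_zero,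
      add_zero]
    congr 1
    split_ifs with h
    · rw [truncate_zero, map_zero]
      rfl
    · exact (hg.hasLineDerivAt p.2 _).lineDeriv.symm
  exists_order f := by
    obtain ⟨r, g, hg⟩ := f.represents_extend.exists_isPullBack
    refine ⟨r, fun σ J hJ => Subtype.ext (funext fun p => ?_)⟩
    refine (hg.hasLineDerivAt p.2 _).lineDeriv.trans ?_
    rw [truncate_partialY_eq_zero σ hJ, map_zero]
    rfl

variable {O}

theorem Represents.d {F : Jet N m → ℝ} {f : JetFun O} (h : Represents F f) (i : Fin N) :
    Represents (totalDeriv i F) ((jetAlgebra O).d i f) :=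
  h.along _ (isAdmissible_totalVec i)

theorem Represents.pd {F : Jet N m → ℝ} {f : JetFun O} (h : Represents F f) (σ : Fin m)
    (J : MultiIndex N) :
    Represents (fun p => lineDeriv ℝ F p (partialY σ J p)) ((jetAlgebra O).pd σ J f) :=
  h.along _ (isAdmissible_partialY σ J)

theorem Represents.dJ {F : Jet N m → ℝ} {f : JetFun O} (h : Represents F f) (J : MultiIndex N) :
    Represents (iter totalDeriv J F) ((jetAlgebra O).dJ J f) :=
  iter_rel totalDeriv _ Represents (fun i _ _ h => h.d i) J h

theorem IsPullBack.hasOrder {r : ℕ} {g : FinJet N m r → ℝ} {F : Jet N m → ℝ} {f : JetFun O}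
    (hg : IsPullBack O r g F) (hF : Represents F f) : (jetAlgebra O).HasOrder r f :=
  fun σ J hJ => Subtype.ext (funext fun p => by
    rw [← hF.pd σ J p]
    dsimp only
    rw [(hg.hasLineDerivAt p.2 _).lineDeriv, truncate_partialY_eq_zero σ hJ,
      map_zero]
    rfl)

/-- The derivative in a vertical direction is a finite sum of partial derivatives. -/
theorem IsPullBack.lineDeriv_vertical {r : ℕ} {g : FinJet N m r → ℝ} {F : Jet N m → ℝ}
    {f : JetFun O} (hg : IsPullBack O r g F) (hF : Represents F f) (p : jetSet O)
    (w : Fin m → MultiIndex N → ℝ) :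
    lineDeriv ℝ F p (0, w) =
      ∑ σ, ∑ J ∈ multiIndices N r, w σ J * ((jetAlgebra O).pd σ J f).1 p := by
  have h1 : truncate r ((0, w) : Jet N m) =
      ∑ σ, ∑ J ∈ multiIndices N r, w σ J • truncate r (partialY σ J p.1) := by
    have h2 : ∀ σ : Fin m, ∀ J : MultiIndex N,
        w σ J • truncate r (partialY σ J p.1) =
          ((0, fun τ K => if τ = σ then (if K.1 = J then w σ J else 0) else 0) :
            FinJet N m r) := fun σ J => by
      refine Prod.ext (smul_zero _) (funext fun τ => funext fun K => ?_)
      by_cases hτ : τ = σ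
      · subst hτ
        simp [truncate, partialY, Pi.single_apply]
      · simp [truncate, partialY, hτ]
    simp_rw [h2]
    refine Prod.ext ?_ (funext fun τ => funext fun K => ?_)
    · simp [Prod.fst_sum, truncate]
    · simp [Prod.snd_sum, truncate, K.2]
  rw [(hg.hasLineDerivAt p.2 _).lineDeriv, h1, map_sum]
  refine Finset.sum_congr rfl fun σ _ => ?_
  rw [map_sum]
  refine Finset.sum_congr rfl fun J _ => ?_
  rw [map_smul, ← hF.pd σ J p]
  dsimp only
  rw [(hg.hasLineDerivAt p.2 _).lineDeriv]
  rfl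

/-- `Φ` is, over `O`, the prolonged vertical vector field with components `u`. -/
def IsProlongation (Φ : JetField N m) (u : Fin m → JetFun O) : Prop :=
  ∀ p : jetSet O, Φ p = (0, fun σ J => ((jetAlgebra O).dJ J (u σ)).1 p)

theorem Represents.prol {F : Jet N m → ℝ} {f : JetFun O} (h : Represents F f) {Φ : JetField N m}
    {u : Fin m → JetFun O} (hΦ : IsProlongation Φ u) :
    Represents (fun p => lineDeriv ℝ F p (Φ p)) ((jetAlgebra O).prol u f) := fun p => by
  obtain ⟨r, g, hg⟩ := h.exists_isPullBack
  dsimp only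
  rw [hΦ p, hg.lineDeriv_vertical h, (hg.hasOrder h).prol_eq]
  simp_rw [JetFun.coe_sum]
  rfl

end JetFunctions

/-! ### Horizontal and vertical components -/

section Components

variable {N m n q : ℕ}

theorem horVec_fst (p v : Jet N m) : (horVec p v).1 = v.1 := by
  unfold horVec totalVec
  rw [Prod.fst_sum]
  funext k
  simp [Pi.single_apply]

theorem vertVec_fst (p v : Jet N m) : (vertVec p v).1 = 0 := by
  rw [vertVec, Prod.fst_sub, horVec_fst, sub_self]

theorem horVec_eq_zero (p : Jet N m) {v : Jet N m} (h : v.1 = 0) : horVec p v = 0 := by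
  simp [horVec, h]

theorem vertVec_eq_self (p : Jet N m) {v : Jet N m} (h : v.1 = 0) : vertVec p v = v := by
  rw [vertVec, horVec_eq_zero p h, sub_zero]

theorem contactPart_zero (α : Form N m q) (p : Jet N m) (v : Fin q → Jet N m) :
    contactPart 0 α p v = α p fun k => horVec p (v k) := by
  simp [contactPart]

theorem contactPart_one (α : Form N m q) (p : Jet N m) (v : Fin q → Jet N m) :
    contactPart 1 α p v =
      ∑ l, α p fun k => if k = l then vertVec p (v k) else horVec p (v k) := by
  simp [contactPart, Finset.powersetCard_one]

/-- An alternating function of tangent vectors is horizontal if it depends only on the components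
along the base and vanishes if one of these is zero. -/
def IsHorizontalFun (c : (Fin q → Jet N m) → ℝ) : Prop :=
  (∀ v w, (∀ k, (v k).1 = (w k).1) → c v = c w) ∧ ∀ v k, (v k).1 = 0 → c v = 0

theorem isHorizontalFun_ds (p : Jet N m) : IsHorizontalFun (ds p) := by
  refine ⟨fun v w h => ?_, fun v k h => ?_⟩
  · unfold ds
    simp only [h]
  · exact Matrix.det_eq_zero_of_row_eq_zero k fun i => by simp [h]

theorem isHorizontalFun_dsContract (j : Fin (n + 1)) (p : Jet (n + 1) m) :
    IsHorizontalFun (dsContract j p) := by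
  refine ⟨fun v w h => ?_, fun v k h => ?_⟩
  · refine (isHorizontalFun_ds p).1 _ _ fun k => ?_
    induction k using Fin.cases with
    | zero => rfl
    | succ k => exact h k
  · exact (isHorizontalFun_ds p).2 _ k.succ h

theorem IsHorizontalFun.sum {ι : Type*} {s : Finset ι} {c : ι → (Fin q → Jet N m) → ℝ}
    (h : ∀ j, IsHorizontalFun (c j)) (F : ι → ℝ) :
    IsHorizontalFun fun v => ∑ j ∈ s, F j * c j v :=
  ⟨fun v w hvw => Finset.sum_congr rfl fun j _ => by rw [(h j).1 v w hvw],
    fun v k hk => Finset.sum_eq_zero fun j _ => by rw [(h j).2 v k hk, mul_zero]⟩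

theorem contactPart_zero_horizontal {α : Form N m q} {p : Jet N m} (h : IsHorizontalFun (α p))
    (v : Fin q → Jet N m) : contactPart 0 α p v = α p v := by
  rw [contactPart_zero]
  exact h.1 _ _ fun k => horVec_fst p (v k)

theorem contactPart_succ_horizontal {α : Form N m q} {p : Jet N m} (h : IsHorizontalFun (α p))
    (l : ℕ) (v : Fin q → Jet N m) : contactPart (l + 1) α p v = 0 := by
  refine Finset.sum_eq_zero fun S hS => ?_
  have hne : S.Nonempty := by
    rw [← Finset.card_pos, (Finset.mem_powersetCard.mp hS).2]
    omega
  obtain ⟨k, hk⟩ := hne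
  refine h.2 _ k ?_
  rw [if_pos hk, vertVec_fst]

theorem ds_cons (p w : Jet (n + 1) m) (v : Fin n → Jet (n + 1) m) :
    ds p (Fin.cons w v) = ∑ j, w.1 j * dsContract j p v := by
  have h : ∀ w : Jet (n + 1) m, ds p (Fin.cons w v) = ∑ j : Fin (n + 1), (-1) ^ (j : ℕ) * w.1 j *
      (Matrix.of fun (k : Fin n) i => (v k).1 (j.succAbove i)).det := fun w => by
    unfold ds
    rw [Matrix.det_succ_row_zero]
    rfl
  unfold dsContract contract
  rw [h w]
  refine Finset.sum_congr rfl fun j _ => ?_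
  rw [h]
  simp [Pi.single_apply]
  ring

/-- The Laplace expansion `∑_k (-1)^k dx^i(v_k) ds_j(v_0, …, v̂_k, …) = δ^i_j ds(v)`. -/
theorem sum_dsContract_removeNth (i j : Fin (n + 1)) (p : Jet (n + 1) m)
    (v : Fin (n + 1) → Jet (n + 1) m) :
    ∑ k : Fin (n + 1), (-1) ^ (k : ℕ) * ((v k).1 i * dsContract j p (k.removeNth v)) =
      if i = j then ds p v else 0 := by
  set A : Matrix (Fin (n + 1)) (Fin (n + 1)) ℝ := Matrix.of fun k i => (v k).1 i with hA
  have h1 : ∀ k : Fin (n + 1),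
      (-1) ^ (k : ℕ) * dsContract j p (k.removeNth v) = A.adjugate j k := fun k => by
    rw [Matrix.adjugate_fin_succ_eq_det_submatrix, pow_add, mul_assoc]
    congr 1
    unfold dsContract contract ds
    rw [Matrix.det_succ_row_zero, Finset.sum_eq_single j]
    · simp
      rfl
    · intro l _ hl
      simp [hl]
    · simp
  have h2 := congrFun (congrFun (Matrix.adjugate_mul A) j) i
  rw [Matrix.mul_apply] at h2
  have h3 : ∀ k : Fin (n + 1), (-1) ^ (k : ℕ) * ((v k).1 i * dsContract j p (k.removeNth v)) =
      A.adjugate j k * A k i := fun k => by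
    rw [← h1 k, hA, Matrix.of_apply]
    ring
  simp_rw [h3]
  rw [h2, Matrix.smul_apply, Matrix.one_apply]
  simp only [eq_comm (a := j), smul_eq_mul, mul_ite, mul_one, mul_zero]
  rfl

end Components

/-! ### Horizontal forms and their coefficients -/

section HorizontalForms

open TopologicalSpace

variable {N m n q : ℕ} {O : Opens (TotalModel N m)}

theorem extD_congr {α β : Form N m q} (h : ∀ p ∈ jetSet O, α p = β p) {p : Jet N m}
    (hp : p ∈ jetSet O) : extD α p = extD β p := by
  funext v
  refine Finset.sum_congr rfl fun k _ => ?_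
  rw [lineDeriv_congr (fun p' hp' => congrFun (h p' hp') _) hp]

theorem extD_eq_zero {α : Form N m q} (h : ∀ p ∈ jetSet O, α p = 0) {p : Jet N m}
    (hp : p ∈ jetSet O) : extD α p = 0 := by
  rw [extD_congr (β := 0) h hp]
  funext v
  refine Finset.sum_eq_zero fun k _ => ?_
  simp [lineDeriv]

/-- `α = ∑_j f_j c_j` over `O`, with constant horizontal forms `c_j`. -/
def HasCoefficients {ι : Type} [Fintype ι] (c : ι → (Fin q → Jet N m) → ℝ) (α : Form N m q)
    (f : ι → JetFun O) : Prop :=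
  (∀ j, IsHorizontalFun (c j)) ∧ ∀ (p : jetSet O) v, α p v = ∑ j, (f j).1 p * c j v

variable {ι : Type} [Fintype ι] {c : ι → (Fin q → Jet N m) → ℝ} {α : Form N m q}
  {f : ι → JetFun O}

theorem HasCoefficients.isHorizontalFun (h : HasCoefficients c α f) (p : jetSet O) :
    IsHorizontalFun (α p) := by
  have : α p = fun v => ∑ j, (f j).1 p * c j v := funext fun v => h.2 p v
  rw [this]
  exact .sum h.1 _

theorem HasCoefficients.congr {β : Form N m q} (h : HasCoefficients c α f)
    (hβ : ∀ (p : jetSet O) v, β p v = α p v) : HasCoefficients c β f :=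
  ⟨h.1, fun p v => (hβ p v).trans (h.2 p v)⟩

theorem HasCoefficients.eq {β : Form N m q} (hα : HasCoefficients c α f)
    (hβ : HasCoefficients c β f) {p : Jet N m} (hp : p ∈ jetSet O) : α p = β p :=
  funext fun v => (hα.2 ⟨p, hp⟩ v).trans (hβ.2 ⟨p, hp⟩ v).symm

theorem HasCoefficients.add {β : Form N m q} {g : ι → JetFun O} (hα : HasCoefficients c α f)
    (hβ : HasCoefficients c β g) : HasCoefficients c (α + β) (f + g) := by
  refine ⟨hα.1, fun p v => ?_⟩
  change α p v + β p v = _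
  rw [hα.2, hβ.2, ← Finset.sum_add_distrib]
  exact Finset.sum_congr rfl fun j _ => (add_mul _ _ _).symm

theorem HasCoefficients.contactPart_zero (h : HasCoefficients c α f) :
    HasCoefficients c (contactPart 0 α) f :=
  h.congr fun p v => contactPart_zero_horizontal (h.isHorizontalFun p) v

theorem HasCoefficients.hasLineDerivAt (h : HasCoefficients c α f) (p : jetSet O) (w : Jet N m)
    (v : Fin q → Jet N m) :
    HasLineDerivAt ℝ (fun p' => α p' v) (∑ j, lineDeriv ℝ (f j).extend p w * c j v) p w := by
  have h1 : ∀ j, HasDerivAt (fun t : ℝ => (f j).extend (p.1 + t • w) * c j v)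
      (lineDeriv ℝ (f j).extend p w * c j v) 0 := fun j => by
    obtain ⟨L, hL⟩ := (f j).represents_extend.exists_linear p.2
    rw [(hL w).lineDeriv]
    exact HasDerivAt.mul_const (hL w) _
  have h2 := HasDerivAt.fun_sum (u := Finset.univ) fun j _ => h1 j
  refine HasDerivAt.congr_of_eventuallyEq h2 ?_
  filter_upwards [eventually_add_smul_mem p.2 w] with t ht
  refine (h.2 ⟨_, ht⟩ v).trans (Finset.sum_congr rfl fun j _ => ?_)
  rw [← (f j).represents_extend ⟨_, ht⟩]

theorem HasCoefficients.extD_apply (h : HasCoefficients c α f) (p : jetSet O)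
    (v : Fin (q + 1) → Jet N m) :
    extD α p v = ∑ k : Fin (q + 1), (-1) ^ (k : ℕ) *
      ∑ j, lineDeriv ℝ (f j).extend p (v k) * c j (k.removeNth v) :=
  Finset.sum_congr rfl fun k _ => by rw [(h.hasLineDerivAt p _ _).lineDeriv]

/-- `d_V` of a horizontal form, contracted with a vertical vector, differentiates the
coefficients. -/
theorem HasCoefficients.contactPart_one_extD (h : HasCoefficients c α f) (p : jetSet O)
    {w : Jet N m} (hw : w.1 = 0) (v : Fin q → Jet N m) :
    contactPart 1 (extD α) p (Fin.cons w v) =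
      ∑ j, lineDeriv ℝ (f j).extend p w * c j v := by
  have hvan : ∀ (x : Fin (q + 1) → Jet N m) (k l : Fin (q + 1)), k ≠ l → (x l).1 = 0 → ∀ j,
      c j (k.removeNth x) = 0 := fun x k l hkl hx j => by
    obtain ⟨i, hi⟩ := Fin.exists_succAbove_eq hkl.symm
    refine (h.1 j).2 _ i ?_
    rw [Fin.removeNth, hi, hx]
  rw [contactPart_one, Finset.sum_eq_single 0]
  · rw [h.extD_apply, Finset.sum_eq_single 0]
    · simp only [Fin.val_zero, pow_zero, one_mul, if_true, Fin.cons_zero, vertVec_eq_self _ hw]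
      refine Finset.sum_congr rfl fun j _ => ?_
      congr 1
      refine (h.1 j).1 _ _ fun k => ?_
      simp [Fin.removeNth, horVec_fst]
    · intro k _ hk
      rw [Finset.sum_eq_zero, mul_zero]
      intro j _
      rw [hvan _ k 0 hk, mul_zero]
      simp [vertVec_fst]
    · simp
  · intro l _ hl
    rw [h.extD_apply]
    refine Finset.sum_eq_zero fun k _ => ?_
    rw [Finset.sum_eq_zero, mul_zero]
    intro j _
    by_cases hk : k = l
    · rw [hvan _ k 0 (by rw [hk]; exact hl), mul_zero]
      simp [Ne.symm hl, horVec_fst, hw]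
    · rw [hvan _ k l hk, mul_zero]
      simp [vertVec_fst]
  · simp

theorem HasCoefficients.dH_apply (h : HasCoefficients c α f) (p : jetSet O)
    (v : Fin (q + 1) → Jet N m) :
    dH α p v = ∑ k : Fin (q + 1), (-1) ^ (k : ℕ) *
      ∑ j, (∑ i, (v k).1 i * ((jetAlgebra O).d i (f j)).1 p) * c j (k.removeNth v) := by
  unfold dH
  rw [Finset.sum_apply, Finset.sum_apply, Finset.sum_range_succ', Finset.sum_eq_zero, zero_add]
  · rw [JetCalculus.contactPart_zero, h.contactPart_zero.extD_apply]
    refine Finset.sum_congr rfl fun k _ => ?_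
    congr 1
    refine Finset.sum_congr rfl fun j _ => ?_
    congr 1
    · obtain ⟨L, hL⟩ := (f j).represents_extend.exists_linear p.2
      rw [(hL _).lineDeriv, horVec, map_sum]
      refine Finset.sum_congr rfl fun i _ => ?_
      rw [map_smul, smul_eq_mul, ← (hL _).lineDeriv]
      exact congrArg _ ((f j).represents_extend.d i p)
    · exact (h.1 j).1 _ _ fun i => horVec_fst _ _
  · intro l _
    have h0 : extD (contactPart (l + 1) α) p = 0 := extD_eq_zero
      (fun p' hp' => funext fun v' =>
        contactPart_succ_horizontal (h.isHorizontalFun ⟨p', hp'⟩) l v') p.2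
    simp [contactPart, h0]

theorem HasCoefficients.dV_apply (h : HasCoefficients c α f) (p : jetSet O)
    (v : Fin (q + 1) → Jet N m) : dV α p v = contactPart 1 (extD α) p v := by
  unfold dV
  rw [Finset.sum_apply, Finset.sum_apply, Finset.sum_range_succ', Finset.sum_eq_zero, zero_add]
  · have h0 : extD (contactPart 0 α) p = extD α p :=
      extD_congr (fun p' hp' => h.contactPart_zero.eq h hp') p.2
    unfold contactPart at *
    rw [h0]
  · intro l _
    have h0 : extD (contactPart (l + 1) α) p = 0 := extD_eq_zero
      (fun p' hp' => funext fun v' =>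
        contactPart_succ_horizontal (h.isHorizontalFun ⟨p', hp'⟩) l v') p.2
    rw [contactPart, h0]
    simp

/-- `Φ ⌋ d_V α` for a prolonged vertical vector field `Φ`. -/
theorem HasCoefficients.contract_dV (h : HasCoefficients c α f) {Φ : JetField N m}
    {u : Fin m → JetFun O} (hΦ : IsProlongation Φ u) :
    HasCoefficients c (contract Φ (dV α)) fun j => (jetAlgebra O).prol u (f j) := by
  refine ⟨h.1, fun p v => ?_⟩
  have hv : (Φ p).1 = 0 := by rw [hΦ p]
  rw [contract, h.dV_apply, h.contactPart_one_extD p hv]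
  exact Finset.sum_congr rfl fun j _ => by rw [← (f j).represents_extend.prol hΦ p]

/-- `α = f ds` over `O`. -/
def IsVolumeForm (α : Form N m N) (f : JetFun O) : Prop :=
  HasCoefficients (fun _ : Unit => ds (m := m) 0) α fun _ => f

theorem isVolumeForm_iff {α : Form N m N} {f : JetFun O} :
    IsVolumeForm α f ↔ ∀ (p : jetSet O) v, α p v = f.1 p * ds p v := by
  simp only [IsVolumeForm, HasCoefficients, Finset.univ_unique, Finset.sum_singleton]
  exact ⟨fun h => h.2, fun h => ⟨fun _ => isHorizontalFun_ds 0, h⟩⟩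

theorem IsVolumeForm.add {α β : Form N m N} {f g : JetFun O} (hα : IsVolumeForm α f)
    (hβ : IsVolumeForm β g) : IsVolumeForm (α + β) (f + g) :=
  HasCoefficients.add hα hβ

theorem IsVolumeForm.d {α : Form N m N} {f : JetFun O} (h : IsVolumeForm α f)
    (i : Fin N) : IsVolumeForm (formalDeriv i α) ((jetAlgebra O).d i f) := by
  rw [isVolumeForm_iff]
  intro p v
  unfold formalDeriv
  rw [(h.hasLineDerivAt p _ _).lineDeriv, Finset.sum_eq_zero (s := (Finset.univ : Finset (Fin N))),
    add_zero, ← f.represents_extend.d i p]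
  · simp [totalDeriv]
    exact Or.inl rfl
  · intro k _
    exact (h.isHorizontalFun p).2 _ k (by simp)

theorem IsVolumeForm.dJ {α : Form N m N} {f : JetFun O} (h : IsVolumeForm α f)
    (J : MultiIndex N) : IsVolumeForm (iter formalDeriv J α) ((jetAlgebra O).dJ J f) :=
  iter_rel formalDeriv _ IsVolumeForm (fun i _ _ h => h.d i) J h

/-- `∂/∂y^σ_J ⌋ p_1 dλ = ∂L/∂y^σ_J ds` for `λ = L ds`. -/
theorem IsVolumeForm.contract_partialY {lam : Form N m N} {f : JetFun O}
    (h : IsVolumeForm lam f) (σ : Fin m) (J : MultiIndex N) :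
    IsVolumeForm (contract (partialY σ J) (contactPart 1 (extD lam)))
      ((jetAlgebra O).pd σ J f) := by
  rw [isVolumeForm_iff]
  intro p v
  rw [contract, h.contactPart_one_extD p rfl, ← f.represents_extend.pd σ J p]
  simp
  exact Or.inl rfl

theorem wedge_cons (θ : Form N m 1) {β : Form N m q} {p : Jet N m} (hβ : IsHorizontalFun (β p))
    {w : Jet N m} (hw : w.1 = 0) (v : Fin q → Jet N m) :
    wedge θ β p (Fin.cons w v) = θ p (fun _ => w) * β p v := by
  rw [wedge, Finset.sum_eq_single 0]
  · simp
  · intro k _ hk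
    obtain ⟨i, hi⟩ := Fin.exists_succAbove_eq (Ne.symm hk)
    have h0 : β p (k.removeNth (Fin.cons w v : Fin (q + 1) → Jet N m)) = 0 :=
      hβ.2 _ i (by rw [Fin.removeNth, hi, Fin.cons_zero, hw])
    rw [h0, mul_zero, mul_zero]
  · simp

theorem contactForm_vertical (σ : Fin m) (p : Jet N m) {w : Jet N m} (hw : w.1 = 0) :
    contactForm σ p (fun _ => w) = w.2 σ 0 := by
  simp [contactForm, hw]

/-- `Φ ⌋ E_n(λ) = u^σ E_σ(L) ds` for `λ = L ds` and a vertical `Φ` with components `u^σ` along the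
total space. -/
theorem IsVolumeForm.contract_eulerLagrange {lam : Form N m N} {f : JetFun O}
    (h : IsVolumeForm lam f) {Φ : JetField N m} {u : Fin m → JetFun O}
    (hΦ : ∀ p : jetSet O, (Φ p).1 = 0 ∧ ∀ σ, (Φ p).2 σ 0 = (u σ).1 p) :
    IsVolumeForm (contract Φ (eulerLagrange lam)) (∑ σ, u σ * (jetAlgebra O).euler σ f) := by
  obtain ⟨R, hR⟩ := (jetAlgebra O).exists_hasOrder f
  have hβ : ∀ σ, IsVolumeForm (fun p v => ∑ᶠ J : MultiIndex N, (-1 : ℝ) ^ (∑ i, J i) *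
      iter formalDeriv J (contract (partialY σ J) (contactPart 1 (extD lam))) p v)
      ((jetAlgebra O).euler σ f) := fun σ => by
    rw [isVolumeForm_iff]
    intro p v
    have h1 := fun J => isVolumeForm_iff.mp ((h.contract_partialY σ J).dJ J) p v
    simp_rw [h1]
    rw [finsum_eq_sum_multiIndices R, hR.euler_eq, JetFun.coe_sum, Finset.sum_mul]
    · refine Finset.sum_congr rfl fun J _ => ?_
      rw [← mul_assoc]
      rfl
    · intro J hJ
      rw [hR σ J hJ, map_zero]
      simp
  rw [isVolumeForm_iff]
  intro p v
  rw [contract, eulerLagrange, interiorEuler]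
  simp only [Nat.cast_one, div_one, one_smul]
  rw [Finset.sum_apply, Finset.sum_apply, JetFun.coe_sum, Finset.sum_mul]
  refine Finset.sum_congr rfl fun σ _ => ?_
  rw [wedge_cons _ ((hβ σ).isHorizontalFun p) (hΦ p).1, contactForm_vertical σ _ (hΦ p).1,
    (hΦ p).2, isVolumeForm_iff.mp (hβ σ) p v, ← mul_assoc]
  rfl

end HorizontalForms

/-! ### Currents, the horizontal differential and the momentum -/

section Currents

open TopologicalSpace

variable {N m n : ℕ} {O : Opens (TotalModel (n + 1) m)}

/-- `α = ∑_j f_j ds_j` over `O`. -/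
def IsCurrent (α : Form (n + 1) m n) (f : Fin (n + 1) → JetFun O) : Prop :=
  HasCoefficients (fun j => dsContract j 0) α f

theorem isCurrent_iff {α : Form (n + 1) m n} {f : Fin (n + 1) → JetFun O} :
    IsCurrent α f ↔ ∀ (p : jetSet O) v, α p v = ∑ j, (f j).1 p * dsContract j p v :=
  ⟨fun h => h.2, fun h => ⟨fun j => isHorizontalFun_dsContract j 0, h⟩⟩

/-- `d_H (f^j ds_j) = d_j f^j ds`. -/
theorem IsCurrent.isVolumeForm_dH {α : Form (n + 1) m n} {f : Fin (n + 1) → JetFun O} (h : IsCurrent α f) :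
    IsVolumeForm (dH α) (∑ j, (jetAlgebra O).d j (f j)) := by
  rw [isVolumeForm_iff]
  intro p v
  rw [HasCoefficients.dH_apply h, JetFun.coe_sum, Finset.sum_mul]
  simp_rw [Finset.mul_sum, Finset.sum_mul]
  rw [Finset.sum_comm]
  refine Finset.sum_congr rfl fun j _ => ?_
  simp_rw [Finset.mul_sum]
  rw [Finset.sum_comm, Finset.sum_eq_single j]
  · rw [← (sum_dsContract_removeNth j j p.1 v).trans (if_pos rfl), Finset.mul_sum]
    refine Finset.sum_congr rfl fun k _ => ?_
    change _ = _ * (_ * (_ * dsContract j 0 _))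
    ring
  · intro i _ hi
    have h0 := (sum_dsContract_removeNth i j p.1 v).trans (if_neg hi)
    calc _ = ((jetAlgebra O).d i (f j)).1 p *
        ∑ k : Fin (n + 1), (-1) ^ (k : ℕ) * ((v k).1 i * dsContract j p.1 (k.removeNth v)) := by
          rw [Finset.mul_sum]
          refine Finset.sum_congr rfl fun k _ => ?_
          change _ = _ * (_ * (_ * dsContract j 0 _))
          ring
      _ = 0 := by rw [h0, mul_zero]
  · simp

theorem IsVolumeForm.contract_horizontal {lam : Form (n + 1) m (n + 1)} {f : JetFun O}
    (h : IsVolumeForm lam f) {Φ : JetField (n + 1) m} {ξ : Fin (n + 1) → JetFun O}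
    (hΦ : ∀ p : jetSet O, ∀ i, (Φ p).1 i = (ξ i).1 p) :
    IsCurrent (contract Φ lam) fun i => ξ i * f := by
  rw [isCurrent_iff]
  intro p v
  rw [contract, isVolumeForm_iff.mp h, ds_cons, Finset.mul_sum]
  refine Finset.sum_congr rfl fun j _ => ?_
  rw [hΦ]
  change _ = (ξ j).1 p * f.1 p * _
  ring

/-- The contact form `ω^σ_K` on a tangent vector. -/
def contactCoord (σ : Fin m) (K : MultiIndex N) (p w : Jet N m) : ℝ :=
  w.2 σ K - ∑ i, p.2 σ (K + unitIndex i) * w.1 i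

theorem contactCoord_horVec (σ : Fin m) (K : MultiIndex N) (p w : Jet N m) :
    contactCoord σ K p (horVec p w) = 0 := by
  rw [contactCoord, horVec_fst, horVec, Prod.snd_sum]
  simp only [Finset.sum_apply, totalVec, Prod.smul_snd, Pi.smul_apply, smul_eq_mul]
  rw [sub_eq_zero]
  exact Finset.sum_congr rfl fun i _ => mul_comm _ _

theorem contactCoord_vertVec (σ : Fin m) (K : MultiIndex N) (p w : Jet N m) :
    contactCoord σ K p (vertVec p w) = contactCoord σ K p w := by
  have h1 : contactCoord σ K p (w - horVec p w) =
      contactCoord σ K p w - contactCoord σ K p (horVec p w) := by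
    simp only [contactCoord, Prod.snd_sub, Prod.fst_sub, Pi.sub_apply, mul_sub,
      Finset.sum_sub_distrib]
    ring
  rw [vertVec, h1, contactCoord_horVec, sub_zero]

theorem hasLineDerivAt_contactCoord (σ : Fin m) (K : MultiIndex N) (i : Fin N) (p w : Jet N m) :
    HasLineDerivAt ℝ (fun p' => contactCoord σ K p' w)
      (-∑ j, p.2 σ (K + unitIndex i + unitIndex j) * w.1 j) p (totalVec i p) := by
  have h : ∀ t : ℝ, contactCoord σ K (p + t • totalVec i p) w = contactCoord σ K p w +
      t * -∑ j, p.2 σ (K + unitIndex i + unitIndex j) * w.1 j := fun t => by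
    simp only [contactCoord, totalVec, Prod.snd_add, Prod.smul_snd, Pi.add_apply, Pi.smul_apply,
      smul_eq_mul, add_mul, Finset.sum_add_distrib, mul_neg, Finset.mul_sum, mul_assoc,
      add_right_comm K]
    ring
  unfold HasLineDerivAt
  simp_rw [h]
  simpa only [one_mul, id] using!
    ((hasDerivAt_id (0 : ℝ)).mul_const _).const_add (contactCoord σ K p w)

/-- `θ` is, over `O`, a combination of the contact forms `ω^σ_K`, and `f` is its value on the
prolonged vertical vector field with components `u`. -/
def IsContactForm {O : Opens (TotalModel N m)} (u : Fin m → JetFun O) (θ : Form N m 1)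
    (f : JetFun O) : Prop :=
  ∃ (ι : Type) (_ : Fintype ι) (Z : ι → JetFun O) (σ : ι → Fin m) (K : ι → MultiIndex N),
    (∀ (p : jetSet O) v, θ p v = ∑ a, (Z a).1 p * contactCoord (σ a) (K a) p (v 0)) ∧
      f = ∑ a, Z a * (jetAlgebra O).dJ (K a) (u (σ a))

variable {O' : Opens (TotalModel N m)} {u : Fin m → JetFun O'} {θ : Form N m 1} {f : JetFun O'}

theorem IsContactForm.apply_horVec (h : IsContactForm u θ f) (p : jetSet O') (w : Jet N m) :
    θ p (fun _ => horVec p w) = 0 := by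
  obtain ⟨ι, _, Z, σ, K, hθ, -⟩ := h
  rw [hθ]
  exact Finset.sum_eq_zero fun a _ => by rw [contactCoord_horVec, mul_zero]

theorem IsContactForm.apply_vertVec (h : IsContactForm u θ f) (p : jetSet O') (w : Jet N m) :
    θ p (fun _ => vertVec p w) = θ p (fun _ => w) := by
  obtain ⟨ι, _, Z, σ, K, hθ, -⟩ := h
  rw [hθ, hθ]
  exact Finset.sum_congr rfl fun a _ => by rw [contactCoord_vertVec]

theorem IsContactForm.apply_prolongation (h : IsContactForm u θ f) {Φ : JetField N m}
    (hΦ : IsProlongation Φ u) (p : jetSet O') : θ p (fun _ => Φ p) = f.1 p := by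
  obtain ⟨ι, _, Z, σ, K, hθ, rfl⟩ := h
  rw [hθ, JetFun.coe_sum, hΦ p]
  refine Finset.sum_congr rfl fun a _ => ?_
  simp [contactCoord]

/-- The formal derivative of a contact form is a contact form, by `d_i ω^σ_K = ω^σ_{Ki}`, and
commutes with the evaluation on a prolonged vertical vector field. -/
theorem IsContactForm.d (h : IsContactForm u θ f) (i : Fin N) :
    IsContactForm u (formalDeriv i θ) ((jetAlgebra O').d i f) := by
  obtain ⟨ι, _, Z, σ, K, hθ, rfl⟩ := h
  refine ⟨ι ⊕ ι, inferInstance, Sum.elim (fun a => (jetAlgebra O').d i (Z a)) Z, Sum.elim σ σ,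
    Sum.elim K fun a => K a + unitIndex i, fun p v => ?_, ?_⟩
  · have h1 : ∀ a, HasDerivAt (fun t : ℝ => (Z a).extend (p.1 + t • totalVec i p.1) *
        contactCoord (σ a) (K a) (p.1 + t • totalVec i p.1) (v 0))
        (((jetAlgebra O').d i (Z a)).1 p * contactCoord (σ a) (K a) p (v 0) + (Z a).1 p *
          -∑ j, p.1.2 (σ a) (K a + unitIndex i + unitIndex j) * (v 0).1 j) 0 := fun a => by
      obtain ⟨L, hL⟩ := (Z a).represents_extend.exists_linear p.2
      have h2 := HasDerivAt.mul (hL (totalVec i p.1))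
        (hasLineDerivAt_contactCoord (σ a) (K a) i p.1 (v 0))
      have h3 : ((jetAlgebra O').d i (Z a)).1 p = L (totalVec i p.1) :=
        ((Z a).represents_extend.d i p).symm.trans (hL _).lineDeriv
      rw [h3, ← (Z a).represents_extend p]
      simpa only [zero_smul, add_zero] using! h2
    have h4 : HasLineDerivAt ℝ (fun p' => θ p' v) _ p.1 (totalVec i p.1) :=
      (HasDerivAt.fun_sum (u := Finset.univ) fun a _ => h1 a).congr_of_eventuallyEq (by
        filter_upwards [eventually_add_smul_mem p.2 (totalVec i p.1)] with t ht
        refine (hθ ⟨_, ht⟩ v).trans (Finset.sum_congr rfl fun a _ => ?_)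
        rw [← (Z a).represents_extend ⟨_, ht⟩])
    unfold formalDeriv
    rw [h4.lineDeriv, Fintype.sum_sum_type, Finset.sum_add_distrib, add_assoc]
    congr 1
    rw [Fin.sum_univ_one, hθ, ← Finset.sum_add_distrib]
    refine Finset.sum_congr rfl fun a _ => ?_
    simp [contactCoord]
    ring
  · rw [Fintype.sum_sum_type, map_sum, ← Finset.sum_add_distrib]
    refine Finset.sum_congr rfl fun a _ => ?_
    simp only [Sum.elim_inl, Sum.elim_inr]
    rw [Derivation.leibniz, smul_eq_mul, smul_eq_mul, JetAlgebra.dJ_add_unitIndex]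
    ring

theorem IsContactForm.dJ (h : IsContactForm u θ f) (J : MultiIndex N) :
    IsContactForm u (iter formalDeriv J θ) ((jetAlgebra O').dJ J f) :=
  iter_rel formalDeriv _ (IsContactForm u) (fun i _ _ h => h.d i) J h

theorem iter_formalDeriv_eq_zero {q : ℕ} {α : Form N m q} (h : ∀ p ∈ jetSet O', α p = 0)
    (J : MultiIndex N) : ∀ p ∈ jetSet O', iter formalDeriv J α p = 0 := by
  refine iter_rel (B := Unit) formalDeriv (fun _ b => b)
    (fun α _ => ∀ p ∈ jetSet O', α p = 0) (fun i α _ hα p hp => ?_) J (b := ()) h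
  funext v
  have h1 : lineDeriv ℝ (fun p' => α p' v) p (totalVec i p) = 0 := by
    rw [lineDeriv_congr (G := fun _ => 0) (fun p' hp' => congrFun (hα p' hp') v) hp]
    simp [lineDeriv]
  simp [formalDeriv, h1, hα p hp]

/-- The coefficients `z^I_σ` for `α = dλ`, `λ = L ds`. -/
theorem IsVolumeForm.represents_zetaCoeff {lam : Form N m N} (h : IsVolumeForm lam f) (σ : Fin m)
    (I : MultiIndex N) :
    Represents (zetaCoeff (extD lam) σ I) ((jetAlgebra O').zeta σ I f) := fun p => by
  obtain ⟨R, hR⟩ := (jetAlgebra O').exists_hasOrder f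
  have hds : ds p.1 (fun i : Fin N => ((Pi.single i 1, 0) : Jet N m)) = 1 := by
    unfold ds
    rw [← Matrix.det_one (n := Fin N)]
    congr 1
    ext k i
    simp [Matrix.one_apply, Pi.single_apply, eq_comm]
  unfold zetaCoeff
  have h1 := fun J => isVolumeForm_iff.mp
    ((h.contract_partialY σ (I + J)).dJ J) p fun i => (Pi.single i 1, 0)
  simp_rw [h1, hds, mul_one]
  rw [finsum_eq_sum_multiIndices R, hR.zeta_eq, JetFun.coe_sum]
  · rfl
  · intro J hJ
    rw [hR σ (I + J), map_zero]
    · simp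
    · simp only [Pi.add_apply, Finset.sum_add_distrib]
      omega

theorem IsVolumeForm.isContactForm_chi {lam : Form N m N} (h : IsVolumeForm lam f)
    (u : Fin m → JetFun O') (I : MultiIndex N) :
    IsContactForm u (chi (extD lam) I) (∑ σ, (jetAlgebra O').zeta σ I f * u σ) := by
  refine ⟨Fin m, inferInstance, fun σ => (jetAlgebra O').zeta σ I f, id, fun _ => 0,
    fun p v => ?_, by simp⟩
  refine Finset.sum_congr rfl fun σ _ => ?_
  rw [h.represents_zetaCoeff σ I p]
  simp [contactForm, contactCoord]

/-- The wedge product of a contact form and a horizontal form is one-contact. -/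
theorem IsContactForm.contactPart_one_wedge {q : ℕ} (h : IsContactForm u θ f) {β : Form N m q}
    (p : jetSet O') (hβ : IsHorizontalFun (β p)) (v : Fin (q + 1) → Jet N m) :
    contactPart 1 (wedge θ β) p v = wedge θ β p v := by
  rw [contactPart_one]
  refine Finset.sum_congr rfl fun l _ => ?_
  rw [wedge, Finset.sum_eq_single l]
  · rw [if_pos rfl, h.apply_vertVec]
    congr 2
    refine hβ.1 _ _ fun i => ?_
    simp [Fin.removeNth, horVec_fst]
  · intro k _ hk
    simp only [if_neg hk]
    rw [h.apply_horVec, zero_mul, mul_zero]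
  · simp

/-- `Φ ⌋ p_{d_V λ}` for a prolonged vertical vector field `Φ`. -/
theorem IsVolumeForm.contract_momentum {lam : Form (n + 1) m (n + 1)} {f : JetFun O}
    (h : IsVolumeForm lam f) {Φ : JetField (n + 1) m} {u : Fin m → JetFun O}
    (hΦ : IsProlongation Φ u) :
    IsCurrent (contract Φ (momentum lam)) ((jetAlgebra O).mom u f) := by
  obtain ⟨R, hR⟩ := (jetAlgebra O).exists_hasOrder f
  have hθ := fun (I : MultiIndex (n + 1)) (j : Fin (n + 1)) =>
    (h.isContactForm_chi u (I + unitIndex j)).dJ I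
  have hres : ∀ (p : jetSet O) v, residual (extD lam) p v =
      -∑ I ∈ multiIndices (n + 1) R, ∑ j, (((I j : ℝ) + 1) / ((∑ i, (I i : ℝ)) + 1)) *
        wedge (iter formalDeriv I (chi (extD lam) (I + unitIndex j))) (dsContract j) p v :=
    fun p v => by
      rw [residual, finsum_eq_sum_multiIndices R]
      intro I hI
      refine Finset.sum_eq_zero fun j _ => ?_
      have h0 : iter formalDeriv I (chi (extD lam) (I + unitIndex j)) p.1 = 0 := by
        refine iter_formalDeriv_eq_zero (fun p' hp' => funext fun w => ?_) I p.1 p.2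
        refine Finset.sum_eq_zero fun σ _ => ?_
        rw [h.represents_zetaCoeff σ _ ⟨p', hp'⟩, hR.zeta_eq_zero σ]
        · simp
        · rw [sum_add_unitIndex]
          omega
      have h1 : wedge (iter formalDeriv I (chi (extD lam) (I + unitIndex j)))
          (dsContract j) p.1 v = 0 := by
        simp [wedge, h0]
      rw [h1, mul_zero]
  rw [isCurrent_iff]
  intro p v
  have hv : (Φ p).1 = 0 := by rw [hΦ p]
  have hw : ∀ (I : MultiIndex (n + 1)) (j : Fin (n + 1)),
      contactPart 1 (wedge (iter formalDeriv I (chi (extD lam) (I + unitIndex j)))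
        (dsContract j)) p (Fin.cons (Φ p) v) =
      ((jetAlgebra O).dJ I (∑ σ, (jetAlgebra O).zeta σ (I + unitIndex j) f * u σ)).1 p *
        dsContract j p v := fun I j => by
    rw [(hθ I j).contactPart_one_wedge p (isHorizontalFun_dsContract j p.1),
      wedge_cons _ (isHorizontalFun_dsContract j p.1) hv, (hθ I j).apply_prolongation hΦ]
  change -contactPart 1 (residual (extD lam)) p.1 (Fin.cons (Φ p.1) v) = _
  rw [contactPart_one]
  simp_rw [hres, Finset.sum_neg_distrib, neg_neg]
  rw [Finset.sum_comm]
  simp_rw [hR.mom_eq, JetFun.coe_sum, Finset.sum_mul]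
  conv_rhs => rw [Finset.sum_comm]
  refine Finset.sum_congr rfl fun I _ => ?_
  rw [Finset.sum_comm]
  refine Finset.sum_congr rfl fun j _ => ?_
  rw [← Finset.mul_sum, ← contactPart_one, hw, ← mul_assoc]
  rfl

end Currents

/-! ### Vector fields in a chart -/

section ChartFields

open VectorField

variable {E : Type*} [NormedAddCommGroup E] [NormedSpace ℝ E]
  {M : Type*} [TopologicalSpace M] [ChartedSpace E M]
  {e : OpenPartialHomeomorph M E}

/-- The vector field `Ξ` in the chart `e`. -/
def chartField (e : OpenPartialHomeomorph M E) (Ξ : (y : M) → TangentSpace 𝓘(ℝ, E) y) (z : E) :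
    E :=
  mfderiv 𝓘(ℝ, E) 𝓘(ℝ, E) e (e.symm z) (Ξ (e.symm z))

theorem mdifferentiable_of_mem_maximalAtlas (he : e ∈ IsManifold.maximalAtlas 𝓘(ℝ, E) ∞ M) :
    e.MDifferentiable 𝓘(ℝ, E) 𝓘(ℝ, E) :=
  ⟨(contMDiffOn_of_mem_maximalAtlas he).mdifferentiableOn (by simp),
    (contMDiffOn_symm_of_mem_maximalAtlas he).mdifferentiableOn (by simp)⟩

theorem inverse_mfderiv_symm (he : e ∈ IsManifold.maximalAtlas 𝓘(ℝ, E) ∞ M) {z : E}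
    (hz : z ∈ e.target) :
    (mfderiv 𝓘(ℝ, E) 𝓘(ℝ, E) e.symm z).inverse = mfderiv 𝓘(ℝ, E) 𝓘(ℝ, E) e (e.symm z) ∧
      (mfderiv 𝓘(ℝ, E) 𝓘(ℝ, E) e.symm z).IsInvertible := by
  have h := mdifferentiable_of_mem_maximalAtlas he
  have h1 := h.symm_comp_deriv (e.map_target hz)
  have h2 := h.comp_symm_deriv hz
  rw [e.right_inv hz] at h1
  exact ⟨ContinuousLinearMap.inverse_eq h1 h2, ContinuousLinearMap.IsInvertible.of_inverse h1 h2⟩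

theorem chartField_eq_mpullback (he : e ∈ IsManifold.maximalAtlas 𝓘(ℝ, E) ∞ M)
    (Ξ : (y : M) → TangentSpace 𝓘(ℝ, E) y) {z : E} (hz : z ∈ e.target) :
    chartField e Ξ z = mpullback 𝓘(ℝ, E) 𝓘(ℝ, E) e.symm Ξ z := by
  rw [mpullback_apply, (inverse_mfderiv_symm he hz).1]
  rfl

theorem contMDiffAt_symm_of_mem_target (he : e ∈ IsManifold.maximalAtlas 𝓘(ℝ, E) ∞ M)
    {z : E} (hz : z ∈ e.target) : ContMDiffAt 𝓘(ℝ, E) 𝓘(ℝ, E) ∞ e.symm z :=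
  (contMDiffOn_symm_of_mem_maximalAtlas he).contMDiffAt (e.open_target.mem_nhds hz)

/-- If a linear map `L` of the model spaces represents `π` in the charts `e` and `b`, it relates
`Ξ` in the chart `e` to the image of `Ξ` under `π` in the chart `b`. -/
theorem apply_chartField {F : Type*} [NormedAddCommGroup F] [NormedSpace ℝ F]
    {X : Type*} [TopologicalSpace X] [ChartedSpace F X] [IsManifold 𝓘(ℝ, F) ∞ X]
    (he : e ∈ IsManifold.maximalAtlas 𝓘(ℝ, E) ∞ M) {b : OpenPartialHomeomorph X F}
    (hb : b ∈ IsManifold.maximalAtlas 𝓘(ℝ, F) ∞ X) {π : M → X}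
    (hπ : ContMDiff 𝓘(ℝ, E) 𝓘(ℝ, F) ∞ π) (hmaps : ∀ y ∈ e.source, π y ∈ b.source)
    (L : E →L[ℝ] F) (hL : ∀ y ∈ e.source, b (π y) = L (e y))
    (Ξ : (y : M) → TangentSpace 𝓘(ℝ, E) y) {z : E} (hz : z ∈ e.target) :
    L (chartField e Ξ z) = mfderiv 𝓘(ℝ, F) 𝓘(ℝ, F) b (π (e.symm z))
      (mfderiv 𝓘(ℝ, E) 𝓘(ℝ, F) π (e.symm z) (Ξ (e.symm z))) := by
  have hy := e.map_target hz
  have h1 : HasMFDerivAt 𝓘(ℝ, E) 𝓘(ℝ, F) (b ∘ π) (e.symm z) _ :=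
    HasMFDerivAt.comp (e.symm z)
      ((mdifferentiable_of_mem_maximalAtlas hb).mdifferentiableAt (hmaps _ hy)).hasMFDerivAt
      ((hπ _).mdifferentiableAt (by simp)).hasMFDerivAt
  have h2 : HasMFDerivAt 𝓘(ℝ, E) 𝓘(ℝ, F) (L ∘ e) (e.symm z) _ :=
    HasMFDerivAt.comp (e.symm z) L.hasMFDerivAt
      ((mdifferentiable_of_mem_maximalAtlas he).mdifferentiableAt hy).hasMFDerivAt
  have h3 : (b ∘ π) =ᶠ[nhds (e.symm z)] L ∘ e := by
    filter_upwards [e.open_source.mem_nhds hy] with y hy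
    exact hL y hy
  have h4 := hasMFDerivAt_unique (h2.congr_of_eventuallyEq h3) h1
  exact congrArg (fun T : E →L[ℝ] F => T (Ξ (e.symm z))) h4

variable [IsManifold 𝓘(ℝ, E) ∞ M] [CompleteSpace E]

theorem contDiffOn_chartField (he : e ∈ IsManifold.maximalAtlas 𝓘(ℝ, E) ∞ M)
    {Ξ : (y : M) → TangentSpace 𝓘(ℝ, E) y}
    (hΞ : ContMDiff 𝓘(ℝ, E) 𝓘(ℝ, E).tangent ∞
      fun y => (⟨y, Ξ y⟩ : TangentBundle 𝓘(ℝ, E) M)) :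
    ContDiffOn ℝ ∞ (chartField e Ξ) e.target := by
  have : IsManifold 𝓘(ℝ, E) 1 M := IsManifold.of_le (n := ∞) (by simp)
  refine ContDiffOn.congr (f := mpullback 𝓘(ℝ, E) 𝓘(ℝ, E) e.symm Ξ) ?_
    fun z hz => chartField_eq_mpullback he Ξ hz
  rw [← contMDiffOn_vectorSpace_iff_contDiffOn]
  intro z hz
  refine ContMDiffAt.contMDiffWithinAt ?_
  exact ContMDiffAt.mpullback_vectorField_preimage (n := ∞) (hΞ _)
    (contMDiffAt_symm_of_mem_target he hz) (inverse_mfderiv_symm he hz).2 (by simp)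

/-- The Lie bracket in a chart. -/
theorem chartField_mlieBracket (he : e ∈ IsManifold.maximalAtlas 𝓘(ℝ, E) ∞ M)
    {Ξ H : (y : M) → TangentSpace 𝓘(ℝ, E) y}
    (hΞ : ContMDiff 𝓘(ℝ, E) 𝓘(ℝ, E).tangent ∞
      fun y => (⟨y, Ξ y⟩ : TangentBundle 𝓘(ℝ, E) M))
    (hH : ContMDiff 𝓘(ℝ, E) 𝓘(ℝ, E).tangent ∞
      fun y => (⟨y, H y⟩ : TangentBundle 𝓘(ℝ, E) M)) {z : E} (hz : z ∈ e.target) :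
    chartField e (mlieBracket 𝓘(ℝ, E) Ξ H) z =
      fderiv ℝ (chartField e H) z (chartField e Ξ z) -
        fderiv ℝ (chartField e Ξ) z (chartField e H z) := by
  have : IsManifold 𝓘(ℝ, E) (minSmoothness ℝ 3) M := IsManifold.of_le (n := ∞) (by
    simpa using WithTop.coe_le_coe.2 (le_top : (3 : ℕ∞) ≤ ⊤))
  have hcongr : ∀ Θ : (y : M) → TangentSpace 𝓘(ℝ, E) y,
      chartField e Θ =ᶠ[nhds z] mpullback 𝓘(ℝ, E) 𝓘(ℝ, E) e.symm Θ := fun Θ => by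
    filter_upwards [e.open_target.mem_nhds hz] with w hw
    exact chartField_eq_mpullback he Θ hw
  have h1 := mpullback_mlieBracket (n := ∞) (f := e.symm) (x₀ := z)
    ((hΞ _).mdifferentiableAt (by simp)) ((hH _).mdifferentiableAt (by simp))
    (contMDiffAt_symm_of_mem_target he hz)
    (by simpa using WithTop.coe_le_coe.2 (le_top : (2 : ℕ∞) ≤ ⊤))
  have h2 : ∀ A B : (x : E) → TangentSpace 𝓘(ℝ, E) x, mlieBracket 𝓘(ℝ, E) A B z = lieBracket ℝ A B z := fun A B => by
    rw [← mlieBracketWithin_univ, mlieBracketWithin_eq_lieBracketWithin]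
    exact congrFun lieBracketWithin_univ z
  refine (chartField_eq_mpullback he _ hz).trans (h1.trans ((h2 _ _).trans ?_))
  rw [← (hcongr Ξ).lieBracket_vectorField_eq (hcongr H)]
  rfl

end ChartFields

/-! ### Prolongations in a fibred chart -/

section FiberedCharts

open TopologicalSpace

variable {N m : ℕ} {X Y : Type*} [TopologicalSpace X] [ChartedSpace (Fin N → ℝ) X]
  [TopologicalSpace Y] [ChartedSpace (TotalModel N m) Y] {π : Y → X}
  (c : FiberedChart (N := N) (m := m) π)

namespace FiberedChart

/-- The image of the chart. -/
def image : Opens (TotalModel N m) := ⟨c.total.target, c.total.open_target⟩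

variable {c} {Ξ H : TotalField N m Y}

theorem isProlongation_prolongV {u : Fin m → JetFun c.image}
    (hu : ∀ σ, Represents (c.vertComponent Ξ σ) (u σ)) : IsProlongation (c.prolongV Ξ) u :=
  fun p => Prod.ext rfl (funext fun σ => funext fun J => (hu σ).dJ J p)

theorem prolongV_apply_zero (p : Jet N m) (σ : Fin m) :
    (c.prolongV Ξ p).2 σ 0 = c.vertComponent Ξ σ p := by
  simp [prolongV, iter_zero]

variable [IsManifold 𝓘(ℝ, TotalModel N m) ∞ Y]

theorem contDiffOn_components (hΞ : IsSmoothField Ξ) :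
    ContDiffOn ℝ ∞ (c.components Ξ) c.total.target :=
  contDiffOn_chartField c.total_mem hΞ

theorem components_mlieBracket (hΞ : IsSmoothField Ξ) (hH : IsSmoothField H)
    {z : TotalModel N m} (hz : z ∈ c.total.target) :
    c.components (VectorField.mlieBracket 𝓘(ℝ, TotalModel N m) Ξ H) z =
      fderiv ℝ (c.components H) z (c.components Ξ z) -
        fderiv ℝ (c.components Ξ) z (c.components H z) :=
  chartField_mlieBracket c.total_mem hΞ hH hz

theorem components_fst_of_isVertical [IsManifold 𝓘(ℝ, Fin N → ℝ) ∞ X]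
    (hπ : IsFiberedManifold (N := N) (m := m) π) (hv : IsVertical π Ξ)
    {z : TotalModel N m} (hz : z ∈ c.total.target) : (c.components Ξ z).1 = 0 := by
  have h := apply_chartField c.total_mem c.base_mem hπ.2.contMDiff c.maps
    (ContinuousLinearMap.fst ℝ (Fin N → ℝ) (Fin m → ℝ)) c.compat Ξ hz
  rw [hv, map_zero] at h
  exact h

/-- The base point of a jet of finite order. -/
def finBasePoint (r : ℕ) : FinJet N m r →L[ℝ] TotalModel N m where
  toFun q := (q.1, fun σ => q.2 σ ⟨0, zero_mem_multiIndices N r⟩)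
  map_add' _ _ := rfl
  map_smul' _ _ := rfl
  cont := by fun_prop

theorem contDiffOn_components_finBasePoint (hΞ : IsSmoothField Ξ) (r : ℕ) :
    ContDiffOn ℝ ∞ (fun q => c.components Ξ (finBasePoint r q)) (finJetSet c.image r) :=
  (contDiffOn_components hΞ).comp (finBasePoint r).contDiff.contDiffOn fun _ hq => hq

theorem isPullBack_components_snd (hΞ : IsSmoothField Ξ) (σ : Fin m) :
    IsPullBack c.image 0 (fun q => (c.components Ξ (finBasePoint 0 q)).2 σ)
      fun p => (c.components Ξ (basePoint p)).2 σ :=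
  ⟨(contDiff_apply ℝ ℝ σ).comp_contDiffOn (contDiffOn_components_finBasePoint hΞ 0).snd,
    fun _ _ => rfl⟩

theorem isPullBack_components_fst (hΞ : IsSmoothField Ξ) (i : Fin N) :
    IsPullBack c.image 0 (fun q => (c.components Ξ (finBasePoint 0 q)).1 i)
      fun p => (c.components Ξ (basePoint p)).1 i :=
  ⟨(contDiff_apply ℝ ℝ i).comp_contDiffOn (contDiffOn_components_finBasePoint hΞ 0).fst,
    fun _ _ => rfl⟩

theorem exists_represents_vertComponent (hΞ : IsSmoothField Ξ) (σ : Fin m) :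
    ∃ f : JetFun c.image, Represents (c.vertComponent Ξ σ) f := by
  have hmem : ∀ i : Fin N, unitIndex i ∈ multiIndices N 1 := fun i => by
    have := sum_add_unitIndex 0 i
    rw [zero_add] at this
    rw [mem_multiIndices, this]
    simp
  refine IsPullBack.exists_represents (r := 1)
    (g := fun q => (c.components Ξ (finBasePoint 1 q)).2 σ -
      ∑ i, q.2 σ ⟨unitIndex i, hmem i⟩ * (c.components Ξ (finBasePoint 1 q)).1 i)
    ⟨?_, fun _ _ => rfl⟩
  have h := contDiffOn_components_finBasePoint (c := c) hΞ 1
  refine ((contDiff_apply ℝ ℝ σ).comp_contDiffOn h.snd).sub (ContDiffOn.sum fun i _ => ?_)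
  refine ContDiffOn.mul ?_ ((contDiff_apply ℝ ℝ i).comp_contDiffOn h.fst)
  exact ContDiff.contDiffOn (by fun_prop)

theorem vertComponent_of_isVertical [IsManifold 𝓘(ℝ, Fin N → ℝ) ∞ X]
    (hπ : IsFiberedManifold (N := N) (m := m) π) (hv : IsVertical π Ξ) (σ : Fin m)
    (p : jetSet c.image) :
    c.vertComponent Ξ σ p = (c.components Ξ (basePoint p.1)).2 σ := by
  have h : (c.components Ξ (basePoint p.1)).1 = 0 := components_fst_of_isVertical hπ hv p.2
  simp [vertComponent, h]

theorem hasOrder_zero_of_isVertical [IsManifold 𝓘(ℝ, Fin N → ℝ) ∞ X]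
    (hπ : IsFiberedManifold (N := N) (m := m) π) (hΞ : IsSmoothField Ξ) (hv : IsVertical π Ξ)
    {σ : Fin m} {u : JetFun c.image} (hu : Represents (c.vertComponent Ξ σ) u) :
    (jetAlgebra c.image).HasOrder 0 u :=
  (isPullBack_components_snd hΞ σ).hasOrder fun p =>
    (vertComponent_of_isVertical hπ hv σ p).symm.trans (hu p)

/-- The prolongation of a vertical vector field differentiates the components of another one. -/
theorem prol_component [IsManifold 𝓘(ℝ, Fin N → ℝ) ∞ X]
    (hπ : IsFiberedManifold (N := N) (m := m) π) (hH : IsSmoothField H) (hΞv : IsVertical π Ξ)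
    (hHv : IsVertical π H) {u : Fin m → JetFun c.image}
    (hu : ∀ σ, Represents (c.vertComponent Ξ σ) (u σ)) {ν : Fin m} {w : JetFun c.image}
    (hw : Represents (c.vertComponent H ν) w) (p : jetSet c.image) :
    ((jetAlgebra c.image).prol u w).1 p =
      (fderiv ℝ (c.components H) (basePoint p.1) (c.components Ξ (basePoint p.1))).2 ν := by
  have hw' : Represents (fun p => (c.components H (basePoint p)).2 ν) w := fun p =>
    (vertComponent_of_isVertical hπ hHv ν p).symm.trans (hw p)
  have hp : basePoint p.1 ∈ c.total.target := p.2
  have hd : HasFDerivAt (c.components H) _ (basePoint p.1) :=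
    (((contDiffOn_components hH).contDiffAt (c.total.open_target.mem_nhds hp)).differentiableAt
      (by simp)).hasFDerivAt
  have hbase : basePoint (c.prolongV Ξ p.1) = c.components Ξ (basePoint p.1) := by
    refine Prod.ext (components_fst_of_isVertical hπ hΞv hp).symm (funext fun σ => ?_)
    exact (prolongV_apply_zero p.1 σ).trans (vertComponent_of_isVertical hπ hΞv σ p)
  rw [← hw'.prol (isProlongation_prolongV hu) p, ← hbase]
  exact HasLineDerivAt.lineDeriv
    (((ContinuousLinearMap.proj (R := ℝ) ν ∘L
      ContinuousLinearMap.snd ℝ (Fin N → ℝ) (Fin m → ℝ)).hasFDerivAt.comp _ hd).hasLineDerivAt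
        (basePoint (c.prolongV Ξ p.1)))

/-- The components of the bracket of vertical vector fields. -/
theorem vertComponent_mlieBracket [IsManifold 𝓘(ℝ, Fin N → ℝ) ∞ X]
    (hπ : IsFiberedManifold (N := N) (m := m) π) (hΞ : IsSmoothField Ξ) (hH : IsSmoothField H)
    (hΞv : IsVertical π Ξ) (hHv : IsVertical π H) {u w : Fin m → JetFun c.image}
    (hu : ∀ σ, Represents (c.vertComponent Ξ σ) (u σ))
    (hw : ∀ σ, Represents (c.vertComponent H σ) (w σ)) (ν : Fin m) (p : jetSet c.image) :
    c.vertComponent (VectorField.mlieBracket 𝓘(ℝ, TotalModel N m) Ξ H) ν p =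
      ((jetAlgebra c.image).prol u (w ν) - (jetAlgebra c.image).prol w (u ν)).1 p := by
  have hp : basePoint p.1 ∈ c.total.target := p.2
  have hfst : ∀ {Θ Λ : TotalField N m Y}, IsSmoothField Θ → IsVertical π Θ →
      (fderiv ℝ (c.components Θ) (basePoint p.1) (c.components Λ (basePoint p.1))).1 = 0 :=
    fun {Θ Λ} hΘ hΘv => by
      have hd : HasFDerivAt (c.components Θ) _ (basePoint p.1) :=
        (((contDiffOn_components hΘ).contDiffAt
          (c.total.open_target.mem_nhds hp)).differentiableAt (by simp)).hasFDerivAt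
      have h1 := (ContinuousLinearMap.fst ℝ (Fin N → ℝ) (Fin m → ℝ)).hasFDerivAt.comp _ hd
      have h2 : HasFDerivAt (fun _ : TotalModel N m => (0 : Fin N → ℝ)) _ (basePoint p.1) :=
        h1.congr_of_eventuallyEq (by
          filter_upwards [c.total.open_target.mem_nhds hp] with z hz
          exact (components_fst_of_isVertical hπ hΘv hz).symm)
      have h3 := h2.unique (hasFDerivAt_const _ _)
      exact congrArg (fun T : TotalModel N m →L[ℝ] Fin N → ℝ =>
        T (c.components Λ (basePoint p.1))) h3
  change _ = ((jetAlgebra c.image).prol u (w ν)).1 p - ((jetAlgebra c.image).prol w (u ν)).1 p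
  rw [prol_component hπ hH hΞv hHv hu (hw ν), prol_component hπ hΞ hHv hΞv hw (hu ν),
    vertComponent, components_mlieBracket hΞ hH hp]
  simp [hfst hΞ hΞv, hfst hH hHv]

end FiberedChart

end FiberedCharts

/-! ### The Lagrangian and the Noether currents -/

section Noether

open TopologicalSpace

variable {N n m r : ℕ}

theorem _root_.ContDiffOn.continuousAlternatingMap_eval {D E F : Type*} [NormedAddCommGroup D]
    [NormedSpace ℝ D] [NormedAddCommGroup E] [NormedSpace ℝ E] [NormedAddCommGroup F]
    [NormedSpace ℝ F] [CompleteSpace F] {ι : Type*} [Fintype ι] {s : Set D} {k : ℕ∞} {ρ : D → E [⋀^ι]→L[ℝ] F}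
    {w : D → ι → E} (hρ : ContDiffOn ℝ k ρ s) (hw : ContDiffOn ℝ k w s) :
    ContDiffOn ℝ k (fun q => ρ q (w q)) s := by
  have h : ContDiff ℝ k fun p : (E [⋀^ι]→L[ℝ] F) × (ι → E) => p.1 p.2 :=
    contDiff_iff_contDiffAt.mpr fun p =>
      ((ContinuousAlternatingMap.toContinuousMultilinearMapCLM (𝕜 := ℝ) (E := E) (F := F)
        (ι := ι) ℝ).analyticOnNhd_uncurry_of_multilinear (s := Set.univ) p
          (Set.mem_univ p)).contDiffAt
  exact h.comp_contDiffOn (hρ.prodMk hw)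

/-- The horizontalization of a smooth `N`-form is a horizontal `N`-form `L ds`. -/
theorem exists_isVolumeForm_horizontalization {O : Opens (TotalModel N m)}
    (ρ : FinJet N m r → FinJet N m r [⋀^Fin N]→L[ℝ] ℝ) (hρ : ContDiffOn ℝ ∞ ρ (finJetSet O r)) :
    ∃ f : JetFun O, IsVolumeForm (horizontalization (pullForm ρ)) f := by
  -- `L` is the value of `ρ` on the total derivative vectors, whose components have order `r + 1`.
  choose s hrs G hG htot using fun i : Fin N => isAdmissible_totalVec (m := m) i r
  have hF : ∃ f : JetFun O, Represents
      (fun p => ρ (truncate r p) fun i => truncate r (totalVec i p)) f := by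
    obtain ⟨S, hr, hS⟩ : ∃ S, r ≤ S ∧ ∀ i, s i ≤ S :=
      ⟨r + ∑ i, s i, Nat.le_add_right _ _, fun i =>
        (Finset.single_le_sum (fun _ _ => Nat.zero_le _) (Finset.mem_univ i)).trans
          (Nat.le_add_left _ _)⟩
    refine IsPullBack.exists_represents (r := S)
      (g := fun q => ρ (restrictJet hr q) fun i => G i (restrictJet (hS i) q))
      ⟨?_, fun p _ => ?_⟩
    · refine ContDiffOn.continuousAlternatingMap_eval
        (hρ.comp (restrictJet hr).contDiff.contDiffOn
          fun _ hq => hq) ?_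
      exact contDiffOn_pi.mpr fun i => ((hG i).comp (restrictJet (hS i)).contDiff).contDiffOn
    · dsimp only
      congr 1
      exact funext fun i => htot i p
  obtain ⟨f, hf⟩ := hF
  refine ⟨f, isVolumeForm_iff.mpr fun p v => ?_⟩
  rw [horizontalization, contactPart_zero, ← hf p]
  have hlin : ∀ w : Jet N m, truncate r (horVec p.1 w) =
      Fintype.linearCombination ℝ (fun i => truncate r (totalVec i p.1)) w.1 := fun w => by
    rw [horVec, Fintype.linearCombination_apply]
    have : ∀ t : Finset (Fin N), truncate r (∑ i ∈ t, w.1 i • totalVec i p.1) =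
        ∑ i ∈ t, w.1 i • truncate r (totalVec i p.1) := fun t => by
      classical
      induction t using Finset.induction_on with
      | empty => rfl
      | insert a t ha ih =>
        rw [Finset.sum_insert ha, Finset.sum_insert ha, truncate_add, truncate_smul, ih]
    exact this _
  unfold pullForm ds
  simp_rw [hlin]
  have key := AlternatingMap.eq_smul_basis_det (R := ℝ) (Pi.basisFun ℝ (Fin N))
    ((ρ (truncate r p.1)).toAlternatingMap.compLinearMap
      (Fintype.linearCombination ℝ (fun i => truncate r (totalVec i p.1))))
  have key' := congrArg (fun T => T fun k => (v k).1) key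
  simp only [AlternatingMap.compLinearMap_apply, AlternatingMap.smul_apply, smul_eq_mul,
    Pi.basisFun_det, Pi.basisFun_apply, Fintype.linearCombination_apply_single, one_smul,
    Matrix.detRowAlternating] at key'
  exact key'

variable {X Y : Type*} [TopologicalSpace X] [ChartedSpace (Fin (n + 1) → ℝ) X]
  [TopologicalSpace Y] [ChartedSpace (TotalModel (n + 1) m) Y] {π : Y → X}
  {c : FiberedChart (N := n + 1) (m := m) π} {Ξ : TotalField (n + 1) m Y}
  {u : Fin m → JetFun c.image} {lam : Form (n + 1) m (n + 1)} {f : JetFun c.image}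

theorem partH_fst (p : Jet (n + 1) m) : (c.partH Ξ p).1 = (c.components Ξ (basePoint p)).1 := by
  unfold FiberedChart.partH totalVec
  rw [Prod.fst_sum]
  funext k
  simp [Pi.single_apply]

theorem isCurrent_noetherCurrent (h : IsVolumeForm lam f) {ξ : Fin (n + 1) → JetFun c.image}
    (hξ : ∀ i, Represents (fun p => (c.components Ξ (basePoint p)).1 i) (ξ i))
    (hu : ∀ σ, Represents (c.vertComponent Ξ σ) (u σ)) :
    IsCurrent (noetherCurrent c Ξ lam)
      ((jetAlgebra c.image).mom u f + fun i => ξ i * f) :=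
  (h.contract_momentum (FiberedChart.isProlongation_prolongV hu)).add
    (h.contract_horizontal fun p i => by rw [partH_fst, ← hξ i p])

theorem isVolumeForm_contract_eulerLagrange (h : IsVolumeForm lam f)
    (hu : ∀ σ, Represents (c.vertComponent Ξ σ) (u σ)) :
    IsVolumeForm (contract (c.prolongV Ξ) (eulerLagrange lam))
      (∑ σ, u σ * (jetAlgebra c.image).euler σ f) :=
  h.contract_eulerLagrange fun p =>
    ⟨rfl, fun σ => (FiberedChart.prolongV_apply_zero p.1 σ).trans (hu σ p)⟩

variable [IsManifold 𝓘(ℝ, TotalModel (n + 1) m) ∞ Y]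

theorem isCurrent_noetherCurrent_of_isVertical [IsManifold 𝓘(ℝ, Fin (n + 1) → ℝ) ∞ X]
    (hπ : IsFiberedManifold (N := n + 1) (m := m) π) (hv : IsVertical π Ξ)
    (h : IsVolumeForm lam f) (hu : ∀ σ, Represents (c.vertComponent Ξ σ) (u σ)) :
    IsCurrent (noetherCurrent c Ξ lam) ((jetAlgebra c.image).mom u f) := by
  have := isCurrent_noetherCurrent (ξ := fun _ => 0) h (fun i p => by
    have := FiberedChart.components_fst_of_isVertical (c := c) hπ hv p.2
    exact congrFun this i) hu
  simpa [Pi.zero_def.symm] using this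

/-- The exchange of successive variations along vertical vector fields. -/
theorem second_variation_forms [IsManifold 𝓘(ℝ, Fin (n + 1) → ℝ) ∞ X]
    (hπ : IsFiberedManifold (N := n + 1) (m := m) π) {Ξ₁ Ξ₂ : TotalField (n + 1) m Y}
    (hΞ₁ : IsSmoothField Ξ₁) (hΞ₂ : IsSmoothField Ξ₂) (hv₁ : IsVertical π Ξ₁)
    (hv₂ : IsVertical π Ξ₂) (h : IsVolumeForm lam f) :
    Set.EqOn
      (contract (c.prolongV Ξ₁)
          (eulerLagrange (contract (c.prolongV Ξ₂) (eulerLagrange lam))) +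
        contract (c.prolongV
          (VectorField.mlieBracket 𝓘(ℝ, TotalModel (n + 1) m) Ξ₂ Ξ₁)) (eulerLagrange lam))
      (contract (c.prolongV Ξ₂)
          (eulerLagrange (contract (c.prolongV Ξ₁) (eulerLagrange lam))) +
        dH (noetherCurrent c Ξ₂ (contract (c.prolongV Ξ₁) (eulerLagrange lam))))
      c.jetDomain := by
  choose u₁ hu₁ using FiberedChart.exists_represents_vertComponent (c := c) hΞ₁
  choose u₂ hu₂ using FiberedChart.exists_represents_vertComponent (c := c) hΞ₂
  have hE₁ := isVolumeForm_contract_eulerLagrange h hu₁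
  have hE₂ := isVolumeForm_contract_eulerLagrange h hu₂
  have hb : IsVolumeForm (contract (c.prolongV
      (VectorField.mlieBracket 𝓘(ℝ, TotalModel (n + 1) m) Ξ₂ Ξ₁)) (eulerLagrange lam)) _ :=
    h.contract_eulerLagrange fun p => ⟨rfl, fun σ =>
      (FiberedChart.prolongV_apply_zero p.1 σ).trans
        (FiberedChart.vertComponent_mlieBracket hπ hΞ₂ hΞ₁ hv₂ hv₁ hu₂ hu₁ σ p)⟩
  have hl := (isVolumeForm_contract_eulerLagrange hE₂ hu₁).add hb
  have hr := (isVolumeForm_contract_eulerLagrange hE₁ hu₂).add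
    (isCurrent_noetherCurrent_of_isVertical hπ hv₂ hE₁ hu₂).isVolumeForm_dH
  rw [JetAlgebra.second_variation _ fun ν =>
    FiberedChart.hasOrder_zero_of_isVertical hπ hΞ₂ hv₂ (hu₂ ν)] at hl
  exact fun p hp => hl.eq hr hp

end Noether

end JetCalculus

end

theorem mainTheorem7 {n m r : ℕ} {X Y : Type*}
    [TopologicalSpace X] [ChartedSpace (Fin (n + 1) → ℝ) X]
    [IsManifold 𝓘(ℝ, Fin (n + 1) → ℝ) ∞ X]
    [TopologicalSpace Y] [ChartedSpace (TotalModel (n + 1) m) Y]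
    [IsManifold 𝓘(ℝ, TotalModel (n + 1) m) ∞ Y]
    (π : Y → X) (hπ : IsFiberedManifold (N := n + 1) (m := m) π)
    (c : FiberedChart (N := n + 1) (m := m) π)
    (ρ : FinJet (n + 1) m r → FinJet (n + 1) m r [⋀^Fin (n + 1)]→L[ℝ] ℝ)
    (hρ : ContDiffOn ℝ ∞ ρ (c.finJetDomain r))
    (lam : Form (n + 1) m (n + 1)) (hlam : lam = horizontalization (pullForm ρ))
    (Ξ₁ Ξ₂ : TotalField (n + 1) m Y) (hΞ₁ : IsSmoothField Ξ₁) (hΞ₂ : IsSmoothField Ξ₂) :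
    -- (1)
    (IsProjectable π Ξ₁ → IsProjectable π Ξ₂ →
      Set.EqOn
        (dH (contract (c.prolongV Ξ₂) (momentum (dH
          (contract (c.prolongV Ξ₁) (momentum lam) + contract (c.partH Ξ₁) lam)))))
        (dH (horizontalization (contract (c.prolongV Ξ₂) (dV
          (contract (c.prolongV Ξ₁) (momentum lam) + contract (c.partH Ξ₁) lam)))))
        c.jetDomain) ∧
    -- (2)
    (IsVertical π Ξ₁ → IsVertical π Ξ₂ →
      Set.EqOn
        (contract (c.prolongV Ξ₁)
            (eulerLagrange (contract (c.prolongV Ξ₂) (eulerLagrange lam))) +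
          contract (c.prolongV
            (VectorField.mlieBracket 𝓘(ℝ, TotalModel (n + 1) m) Ξ₂ Ξ₁)) (eulerLagrange lam))
        (contract (c.prolongV Ξ₂)
            (eulerLagrange (contract (c.prolongV Ξ₁) (eulerLagrange lam))) +
          dH (noetherCurrent c Ξ₂ (contract (c.prolongV Ξ₁) (eulerLagrange lam))))
        c.jetDomain) ∧
    -- (3)
    (IsVertical π Ξ₁ → IsVertical π Ξ₂ →
      Set.EqOn
        (dH (noetherCurrent c Ξ₂ (contract (c.prolongV Ξ₁) (eulerLagrange lam))) +
          dH (noetherCurrent c Ξ₁ (contract (c.prolongV Ξ₂) (eulerLagrange lam))))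
        0 c.jetDomain) := by
  obtain ⟨f, hf⟩ := exists_isVolumeForm_horizontalization (O := c.image) ρ hρ
  rw [← hlam] at hf
  choose u₁ hu₁ using FiberedChart.exists_represents_vertComponent (c := c) hΞ₁
  choose u₂ hu₂ using FiberedChart.exists_represents_vertComponent (c := c) hΞ₂
  refine ⟨fun _ _ => ?_, fun hv₁ hv₂ => second_variation_forms hπ hΞ₁ hΞ₂ hv₁ hv₂ hf,
    fun hv₁ hv₂ p hp => ?_⟩
  · choose ξ hξ using fun i =>
      (FiberedChart.isPullBack_components_fst (c := c) hΞ₁ i).exists_represents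
    have hε := isCurrent_noetherCurrent hf hξ hu₁
    have hΦ := FiberedChart.isProlongation_prolongV hu₂
    have hl := (hε.isVolumeForm_dH.contract_momentum hΦ).isVolumeForm_dH
    have hr := IsCurrent.isVolumeForm_dH (hε.contract_dV hΦ).contactPart_zero
    rw [JetAlgebra.divergence_mom] at hl
    simp only [map_sum, JetAlgebra.euler_d, JetAlgebra.prol_d, Finset.sum_const_zero, mul_zero,
      sub_zero] at hl
    exact fun p hp => hl.eq hr hp
  · have h₁ := isVolumeForm_contract_eulerLagrange hf hu₁
    have h₂ := isVolumeForm_contract_eulerLagrange hf hu₂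
    have h := (isCurrent_noetherCurrent_of_isVertical hπ hv₂ h₁ hu₂).isVolumeForm_dH.add
      (isCurrent_noetherCurrent_of_isVertical hπ hv₁ h₂ hu₁).isVolumeForm_dH
    rw [JetAlgebra.divergence_mom_antisymm _
      (fun ν => FiberedChart.hasOrder_zero_of_isVertical hπ hΞ₁ hv₁ (hu₁ ν))
      (fun ν => FiberedChart.hasOrder_zero_of_isVertical hπ hΞ₂ hv₂ (hu₂ ν))] at h
    funext v
    refine (isVolumeForm_iff.mp h ⟨p, hp⟩ v).trans ?_
    simp
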